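/- Let $SO(6)/SO(3)\cdot SO(2)$ be the homogeneous space in which $H=SO(3)\cdot SO(2)$ is embedded in $SO(6)$ as the block diagonal matrices $\mathrm{diag}(1,P,Q)$, $P\in SO(3)$, $Q\in SO(2)$. Let $B(X,Y)=-\mathrm{tr}(XY)$ on $\mathfrak{so}(6)$, let $\mathfrak h$ be the Lie algebra of $H$, $\mathfrak m=\mathfrak h^{\perp}$, and let $X_{\mathfrak m}$ denote the $\mathfrak m$-component of $X$. Put $\xi_{kl}=E_{kl}-E_{lk}$ and $\mathfrak m_{12}=\mathrm{span}\{\xi_{12},\xi_{13},\xi_{14}\}$, $\mathfrak m_{13}=\mathrm{span}\{\xi_{15},\xi_{16}\}$, $\mathfrak m_{23}=\mathrm{span}\{\xi_{kl}: k\in\{2,3,4\},\ l\in\{5,6\}\}$, so $\mathfrak m=\mathfrak m_{12}\oplus\mathfrak m_{13}\oplus\mathfrak m_{23}$. The $SO(6)$-invariant Riemannian metrics correspond to the operators $\Lambda:\mathfrak m\to\mathfrak m$ that are $B$-symmetric, positive definite and $\mathrm{Ad}(H)$-equivariant, the inner product on $\mathfrak m\cong T_o(SO(6)/SO(3)\cdot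 SO(2))$ being $B(\Lambda\cdot,\cdot)$. A vector $X\in\mathfrak m$ is called equigeodesic if the curve $t\mapsto\exp(tX)\cdot o$ (with $o=eH$) is a geodesic for every $SO(6)$-invariant metric (the zero vector, with its constant curve, is included), and trivial if it lies in one of $\mathfrak m_{12},\mathfrak m_{13},\mathfrak m_{23}$. (i) For $X=\sum a_{kl}\xi_{kl}\in\mathfrak m$ the following are equivalent: $X$ is equigeodesic; $[X,\Lambda X]_{\mathfrak m}=0$ for every invariant metric $\Lambda$; the coefficients satisfy the (not identically zero) system $$a_{15}a_{12}=a_{15}a_{13}=a_{15}a_{14}=a_{16}a_{12}=a_{16}a_{13}=a_{16}a_{14}=0,$$ $$a_{25}a_{12}+a_{35}a_{13}+a_{45}a_{14}=0,\qquad a_{26}a_{12}+a_{36}a_{13}+a_{46}a_{14}=0,$$ $$a_{25}a_{15}+a_{26}a_{16}=0,\qquad a_{35}a_{15}+a_{36}a_{16}=0,\qquad a_{45}a_{15}+a_{46}a_{16}=0.$$ (ii) The set of equigeodesic vectors is the union of the following six families, where the $a_{kl}$ are real parameters: 1. $a_{12}\xi_{12}+a_{13}\xi_{13}+a_{14}\xi_{14}+a_{25}\xi_{25}+a_{26}\xi_{26}+a_{35}\xi_{35}+a_{36}\xi_{36}-\frac{a_{12}a_{25}+a_{13}a_{35}}{a_{14}}\xi_{45}-\frac{a_{12}a_{26}+a_{13}a_{36}}{a_{14}}\xi_{46}$,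 $a_{14}\neq0$; 2. $a_{12}\xi_{12}+a_{13}\xi_{13}+a_{25}\xi_{25}+a_{26}\xi_{26}+a_{45}\xi_{45}+a_{46}\xi_{46}-\frac{a_{12}a_{25}}{a_{13}}\xi_{35}-\frac{a_{12}a_{26}}{a_{13}}\xi_{36}$, $a_{13}\neq0$; 3. $a_{12}\xi_{12}+a_{35}\xi_{35}+a_{36}\xi_{36}+a_{45}\xi_{45}+a_{46}\xi_{46}$; 4. $a_{15}\xi_{15}+a_{16}\xi_{16}+a_{25}\xi_{25}-\frac{a_{15}a_{25}}{a_{16}}\xi_{26}+a_{35}\xi_{35}-\frac{a_{15}a_{35}}{a_{16}}\xi_{36}+a_{45}\xi_{45}-\frac{a_{15}a_{45}}{a_{16}}\xi_{46}$, $a_{16}\neq0$; 5. $a_{15}\xi_{15}+a_{26}\xi_{26}+a_{36}\xi_{36}+a_{46}\xi_{46}$; 6. $a_{25}\xi_{25}+a_{26}\xi_{26}+a_{35}\xi_{35}+a_{36}\xi_{36}+a_{45}\xi_{45}+a_{46}\xi_{46}$. Families 1–3 lie in $\mathfrak m_{12}\oplus\mathfrak m_{23}$, families 4–5 lie in $\mathfrak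 m_{13}\oplus\mathfrak m_{23}$, and family 6 equals $\mathfrak m_{23}$. None of the six families is contained in the union of the other five. (iii) Family 6 is the only one of the six families all of whose members are trivial. -/

import Mathlib

open scoped Matrix ContDiff

namespace Wallach

/-- Real `6 × 6` matrices. Rows and columns are numbered `0, …, 5`. -/
abbrev Mat6 : Type := Matrix (Fin 6) (Fin 6) ℝ

/-- The group `SO(6)`. -/
abbrev SO6 : Type := Matrix.specialOrthogonalGroup (Fin 6) ℝ

/-- The partition of the six indices into consecutive blocks of sizes
`n₁ = 1`, `n₂ = 3`, `n₃ = 2`. -/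
def blk : Fin 6 → Fin 3 := ![0, 1, 1, 1, 2, 2]

/-! ### The groups `SO(6)` and `H = SO(1) × SO(3) × SO(2)` -/

theorem mem_SO6_iff {A : Mat6} :
    A ∈ Matrix.specialOrthogonalGroup (Fin 6) ℝ ↔ A * Aᵀ = 1 ∧ A.det = 1 := by
  exact Matrix.mem_specialOrthogonalGroup_iff.trans
    (and_congr_left fun _ => Matrix.mem_orthogonalGroup_iff _ _)

theorem SO6.mul_transpose (g : SO6) : (g : Mat6) * (g : Mat6)ᵀ = 1 :=
  (mem_SO6_iff.1 g.2).1

theorem SO6.transpose_mul (g : SO6) : (g : Mat6)ᵀ * (g : Mat6) = 1 :=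
  mul_eq_one_comm.1 g.mul_transpose

theorem SO6.coe_inv (g : SO6) : ((g⁻¹ : SO6) : Mat6) = (g : Mat6)ᵀ := rfl

theorem SO6.coe_mul (g h : SO6) : ((g * h : SO6) : Mat6) = (g : Mat6) * (h : Mat6) := rfl

/-- A matrix is block diagonal if its entries outside of the diagonal blocks vanish. -/
def IsBlockDiag (A : Mat6) : Prop := ∀ i j, blk i ≠ blk j → A i j = 0

theorem IsBlockDiag.transpose {A : Mat6} (hA : IsBlockDiag A) : IsBlockDiag Aᵀ :=
  fun i j hij => hA j i (Ne.symm hij)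

theorem IsBlockDiag.mul {A C : Mat6} (hA : IsBlockDiag A) (hC : IsBlockDiag C) :
    IsBlockDiag (A * C) := by
  intro i j hij
  rw [Matrix.mul_apply]
  refine Finset.sum_eq_zero fun k _ => ?_
  by_cases h : blk i = blk k
  · rw [hC k j (h ▸ hij), mul_zero]
  · rw [hA i k h, zero_mul]

theorem IsBlockDiag.toSquareBlock_mul {A C : Mat6} (hA : IsBlockDiag A) (k : Fin 3) :
    (A * C).toSquareBlock blk k = A.toSquareBlock blk k * C.toSquareBlock blk k := by
  ext i j
  have key : (∑ x, A i x * C x j) = ∑ x : {x // blk x = k}, A i x * C x j := by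
    rw [← Finset.sum_subtype (Finset.univ.filter fun x => blk x = k) (by simp)
      (fun x => A i x * C x j), Finset.sum_filter]
    refine Finset.sum_congr rfl fun x _ => ?_
    split_ifs with h
    · rfl
    · rw [hA i x (by rw [i.2]; exact fun h' => h h'.symm), zero_mul]
  simpa [Matrix.toSquareBlock_def, Matrix.mul_apply] using key

/-- The subgroup `H = SO(1) × SO(3) × SO(2)` (that is, `SO(3) · SO(2)`) of `SO(6)`, embedded
block diagonally: the block diagonal elements of `SO(6)`, all of whose diagonal blocks
have determinant one. -/
def H : Subgroup SO6 where
  carrier := {g | IsBlockDiag (g : Mat6) ∧ ∀ k, ((g : Mat6).toSquareBlock blk k).det = 1}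
  one_mem' := by
    refine ⟨fun i j hij => Matrix.one_apply_ne fun h => hij (h ▸ rfl), fun k => ?_⟩
    have : ((1 : SO6) : Mat6).toSquareBlock blk k = 1 := by
      ext i j
      simp [Matrix.toSquareBlock_def, Matrix.one_apply, Subtype.ext_iff]
    rw [this, Matrix.det_one]
  mul_mem' := by
    rintro g h ⟨hg, hg'⟩ ⟨hh, hh'⟩
    refine ⟨hg.mul hh, fun k => ?_⟩
    rw [SO6.coe_mul, hg.toSquareBlock_mul, Matrix.det_mul, hg' k, hh' k, one_mul]
  inv_mem' := by
    rintro g ⟨hg, hg'⟩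
    refine ⟨hg.transpose, fun k => ?_⟩
    rw [← hg' k, ← Matrix.det_transpose]
    rfl

/-- The homogeneous space `SO(6)/SO(3)·SO(2)`. -/
abbrev M : Type := SO6 ⧸ H

/-! ### The reductive decomposition -/

/-- The form `B(X, Y) = -tr(XY)`. -/
noncomputable def B (X Y : Mat6) : ℝ := -(X * Y).trace

/-- The Lie algebra `so(6)` of skew-symmetric matrices. -/
def so6 : Submodule ℝ Mat6 where
  carrier := {X | Xᵀ = -X}
  zero_mem' := by simp
  add_mem' := by
    intro X Y hX hY
    simp only [Set.mem_ofPred_eq] at *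
    rw [Matrix.transpose_add, hX, hY, neg_add]
  smul_mem' := by
    intro c X hX
    simp only [Set.mem_ofPred_eq] at *
    rw [Matrix.transpose_smul, hX, smul_neg]

/-- The Lie algebra `𝔥 = so(1) ⊕ so(3) ⊕ so(2)` of `H`. -/
def 𝔥 : Submodule ℝ Mat6 where
  carrier := {X | X ∈ so6 ∧ IsBlockDiag X}
  zero_mem' := ⟨so6.zero_mem, fun _ _ _ => rfl⟩
  add_mem' := by
    rintro X Y ⟨hX, hX'⟩ ⟨hY, hY'⟩
    exact ⟨so6.add_mem hX hY, fun i j h => by simp [hX' i j h, hY' i j h]⟩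
  smul_mem' := by
    rintro c X ⟨hX, hX'⟩
    exact ⟨so6.smul_mem c hX, fun i j h => by simp [hX' i j h]⟩

/-- The orthogonal complement `𝔪` of `𝔥` in `so(6)` with respect to `B`. It is identified with
the tangent space of `SO(6)/SO(3)·SO(2)` at the origin. -/
def 𝔪 : Submodule ℝ Mat6 where
  carrier := {X | X ∈ so6 ∧ ∀ Y ∈ 𝔥, B X Y = 0}
  zero_mem' := ⟨so6.zero_mem, fun _ _ => by simp [B]⟩
  add_mem' := by
    rintro X Y ⟨hX, hX'⟩ ⟨hY, hY'⟩
    refine ⟨so6.add_mem hX hY, fun Z hZ => ?_⟩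
    have h1 := hX' Z hZ
    have h2 := hY' Z hZ
    simp only [B, neg_eq_zero] at *
    rw [add_mul, Matrix.trace_add, h1, h2, add_zero]
  smul_mem' := by
    rintro c X ⟨hX, hX'⟩
    refine ⟨so6.smul_mem c hX, fun Z hZ => ?_⟩
    have h1 := hX' Z hZ
    simp only [B, neg_eq_zero] at *
    rw [Matrix.smul_mul, Matrix.trace_smul, h1, smul_zero]

theorem mem_so6_iff {X : Mat6} : X ∈ so6 ↔ ∀ i j, X i j = -X j i := by
  constructor
  · intro h i j
    have := congrFun (congrFun (show Xᵀ = -X from h) j) i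
    simpa using this
  · intro h
    show Xᵀ = -X
    ext i j
    simpa using h j i

/-- The matrices `ξ_{ab} = E_{ab} - E_{ba}`; note that `a` and `b` are counted from zero, so that
`xi 0 1` is `ξ₁₂` in the usual numbering. -/
def xi (a b : Fin 6) : Mat6 := Matrix.single a b 1 - Matrix.single b a 1

theorem xi_mem_so6 (a b : Fin 6) : xi a b ∈ so6 := by
  show (xi a b)ᵀ = -xi a b
  simp [xi, Matrix.transpose_sub]

/-- `𝔪` consists of the skew-symmetric matrices with vanishing diagonal blocks. -/
theorem mem_𝔪_iff {X : Mat6} : X ∈ 𝔪 ↔ X ∈ so6 ∧ ∀ i j, blk i = blk j → X i j = 0 := by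
  constructor
  · rintro ⟨hX, h⟩
    refine ⟨hX, fun i j hij => ?_⟩
    have hm : xi i j ∈ 𝔥 := by
      refine ⟨xi_mem_so6 i j, fun k l hkl => ?_⟩
      have h1 : ¬ (i = k ∧ j = l) := by rintro ⟨rfl, rfl⟩; exact hkl hij
      have h2 : ¬ (j = k ∧ i = l) := by rintro ⟨rfl, rfl⟩; exact hkl hij.symm
      simp [xi, h1, h2]
    have h3 := h _ hm
    have h4 := mem_so6_iff.1 hX i j
    simp only [B, xi, mul_sub, Matrix.trace_sub, Matrix.trace_mul_single] at h3
    simp at h3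
    linarith
  · rintro ⟨hX, h⟩
    refine ⟨hX, fun Y hY => ?_⟩
    simp only [B, neg_eq_zero, Matrix.trace, Matrix.diag, Matrix.mul_apply]
    refine Finset.sum_eq_zero fun i _ => Finset.sum_eq_zero fun j _ => ?_
    by_cases hij : blk i = blk j
    · rw [h i j hij, zero_mul]
    · rw [hY.2 j i (Ne.symm hij), mul_zero]

/-- The modules `𝔪_{ij}` (for `i < j`): the span of the `ξ_{ab}` with `a` in the `i`-th and `b` in
the `j`-th block. -/
def 𝔪sub (i j : Fin 3) : Submodule ℝ Mat6 :=
  Submodule.span ℝ {X | ∃ a b : Fin 6, blk a = i ∧ blk b = j ∧ X = xi a b}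

def 𝔪12 : Submodule ℝ Mat6 := 𝔪sub 0 1
def 𝔪13 : Submodule ℝ Mat6 := 𝔪sub 0 2
def 𝔪23 : Submodule ℝ Mat6 := 𝔪sub 1 2

/-- The projection onto `𝔪`, written `X ↦ X_𝔪`. It is the `B`-orthogonal projection; on
`so(6) = 𝔥 ⊕ 𝔪` it is the projection along `𝔥`. -/
noncomputable def proj (X : Mat6) : 𝔪 :=
  ⟨Matrix.of fun i j => if blk i = blk j then 0 else (X i j - X j i) / 2, by
    refine mem_𝔪_iff.2 ⟨mem_so6_iff.2 fun i j => ?_, fun i j h => ?_⟩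
    · by_cases h : blk i = blk j
      · simp [h]
      · have h' : ¬ blk j = blk i := Ne.symm h
        simp only [Matrix.of_apply, if_neg h, if_neg h']
        ring
    · simp [h]⟩

theorem proj_of_mem_𝔪 (X : 𝔪) : proj X = X := by
  obtain ⟨hX, h⟩ := mem_𝔪_iff.1 X.2
  ext i j
  by_cases hij : blk i = blk j
  · simp [proj, hij, h i j hij]
  · have := mem_so6_iff.1 hX i j
    simp only [proj, Matrix.of_apply, if_neg hij]
    linarith

theorem proj_of_mem_𝔥 {X : Mat6} (hX : X ∈ 𝔥) : proj X = 0 := by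
  ext i j
  by_cases hij : blk i = blk j
  · simp [proj, hij]
  · simp [proj, hij, hX.2 i j hij, hX.2 j i (Ne.symm hij)]

theorem sub_proj_mem_𝔥 {X : Mat6} (hX : X ∈ so6) : X - proj X ∈ 𝔥 := by
  refine ⟨so6.sub_mem hX (proj X).2.1, fun i j hij => ?_⟩
  have := mem_so6_iff.1 hX i j
  simp only [proj, Matrix.sub_apply, Matrix.of_apply, if_neg hij]
  linarith

/-! ### Invariant metrics -/

theorem conj_mem_𝔪 {h : SO6} (hh : h ∈ H) {X : Mat6} (hX : X ∈ 𝔪) :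
    (h : Mat6) * X * (h : Mat6)ᵀ ∈ 𝔪 := by
  obtain ⟨hX1, hX2⟩ := hX
  have hs : Xᵀ = -X := hX1
  refine ⟨?_, fun Y hY => ?_⟩
  · show ((h : Mat6) * X * (h : Mat6)ᵀ)ᵀ = _
    simp [Matrix.transpose_mul, hs, Matrix.mul_assoc]
  · have hYs : Yᵀ = -Y := hY.1
    have hY' : (h : Mat6)ᵀ * Y * (h : Mat6) ∈ 𝔥 := by
      refine ⟨?_, (hh.1.transpose.mul hY.2).mul hh.1⟩
      show ((h : Mat6)ᵀ * Y * (h : Mat6))ᵀ = _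
      simp [Matrix.transpose_mul, hYs, Matrix.mul_assoc]
    have := hX2 _ hY'
    simp only [B, neg_eq_zero] at *
    rw [← this, Matrix.mul_assoc, Matrix.mul_assoc, Matrix.trace_mul_comm]
    simp only [Matrix.mul_assoc]

/-- The isotropy representation `Ad(h) X = h X h⁻¹` of `H` on `𝔪`. -/
def Ad (h : H) (X : 𝔪) : 𝔪 :=
  ⟨((h : SO6) : Mat6) * X * (((h : SO6)⁻¹ : SO6) : Mat6), conj_mem_𝔪 h.2 X.2⟩

/-- An `SO(6)`-invariant Riemannian metric on `SO(6)/SO(3)·SO(2)`, given by its operator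
`Λ : 𝔪 → 𝔪`, which is symmetric and positive definite with respect to `B` and commutes with the
isotropy representation. The inner product on `𝔪` is `⟨X, Y⟩ = B(ΛX, Y)`. -/
structure InvariantMetric where
  op : 𝔪 →ₗ[ℝ] 𝔪
  symm : ∀ X Y : 𝔪, B (op X) Y = B X (op Y)
  pos : ∀ X : 𝔪, X ≠ 0 → 0 < B (op X) X
  equivariant : ∀ (h : H) (X : 𝔪), op (Ad h X) = Ad h (op X)

/-- The inner product `⟨X, Y⟩ = B(ΛX, Y)` on `𝔪`. -/
noncomputable def InvariantMetric.inner (Λ : InvariantMetric) (X Y : 𝔪) : ℝ := B (Λ.op X) Y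

/-! ### Geodesics

Smooth maps into `SO(6)/SO(3)·SO(2)` are handled through smooth lifts to `SO(6)`. Smoothness and
derivatives of maps into matrices are taken entry by entry. -/

/-- A smooth curve in `SO(6)`. -/
def IsSmoothCurve (g : ℝ → SO6) : Prop :=
  ∀ i j, ContDiff ℝ ∞ fun t => (g t : Mat6) i j

/-- A smooth two-parameter family in `SO(6)`. -/
def IsSmoothFamily (f : ℝ → ℝ → SO6) : Prop :=
  ∀ i j, ContDiff ℝ ∞ fun p : ℝ × ℝ => (f p.1 p.2 : Mat6) i j

/-- The element of `𝔪` that represents the velocity at time `t` of the curve `g(t)H`: the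
velocity is the image of `(g⁻¹ g')_𝔪` under the differential of the translation by `g(t)`. -/
noncomputable def velocity (g : ℝ → SO6) (t : ℝ) : 𝔪 :=
  proj ((((g t)⁻¹ : SO6) : Mat6) * Matrix.of fun i j => deriv (fun r => (g r : Mat6) i j) t)

/-- The energy on `[a, b]` of the curve `g(t)H` in `SO(6)/SO(3)·SO(2)` for the metric `Λ`. As
`Λ` is `Ad(H)`-invariant it does not depend on the choice of the smooth lift `g`. -/
noncomputable def energy (Λ : InvariantMetric) (a b : ℝ) (g : ℝ → SO6) : ℝ :=
  (1 / 2) * ∫ t in a..b, Λ.inner (velocity g t) (velocity g t)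

/-- A smooth curve `γ` in `SO(6)/SO(3)·SO(2)` is a geodesic of the metric `Λ` if on each compact
interval `[a, b]` it is a critical point of the energy under smooth variations with fixed end
points. Variations `f(s, t)H` are given by smooth maps `f` into `SO(6)`. -/
def IsGeodesic (Λ : InvariantMetric) (γ : ℝ → M) : Prop :=
  (∃ g : ℝ → SO6, IsSmoothCurve g ∧ ∀ t, (g t : M) = γ t) ∧
  ∀ (a b : ℝ) (_ : a < b) (f : ℝ → ℝ → SO6), IsSmoothFamily f →
    (∀ t ∈ Set.Icc a b, (f 0 t : M) = γ t) →
    (∀ s, (f s a : M) = γ a) → (∀ s, (f s b : M) = γ b) →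
    HasDerivAt (fun s => energy Λ a b (f s)) 0 0

/-! ### Equigeodesic vectors -/

theorem exp_mem_SO6 {X : Mat6} (hX : X ∈ so6) :
    NormedSpace.exp X ∈ Matrix.specialOrthogonalGroup (Fin 6) ℝ := by
  have key : ∀ Y : Mat6, Y ∈ so6 → NormedSpace.exp Y * (NormedSpace.exp Y)ᵀ = 1 := by
    intro Y hY
    rw [← Matrix.exp_transpose, show Yᵀ = -Y from hY,
      ← Matrix.exp_add_of_commute _ _ ((Commute.refl Y).neg_right), add_neg_cancel,
      NormedSpace.exp_zero]
  refine mem_SO6_iff.2 ⟨key X hX, ?_⟩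
  have hd : (NormedSpace.exp X).det * (NormedSpace.exp X).det = 1 := by
    have := congrArg Matrix.det (key X hX)
    rwa [Matrix.det_mul, Matrix.det_transpose, Matrix.det_one] at this
  have hs : NormedSpace.exp X =
      NormedSpace.exp ((1 / 2 : ℝ) • X) * NormedSpace.exp ((1 / 2 : ℝ) • X) := by
    rw [← Matrix.exp_add_of_commute _ _ (Commute.refl _), ← add_smul]
    norm_num
  have hp : 0 ≤ (NormedSpace.exp X).det := by
    rw [hs, Matrix.det_mul]
    exact mul_self_nonneg _
  nlinarith

/-- The curve `t ↦ exp(tX)·o`, where `o = H` is the origin. -/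
noncomputable def orbit (X : so6) (t : ℝ) : M :=
  ((⟨NormedSpace.exp ((t • X : so6) : Mat6), exp_mem_SO6 (t • X).2⟩ : SO6) : M)

/-- `X ∈ 𝔪` is an equigeodesic vector if `t ↦ exp(tX)·o` is a geodesic for every
`SO(6)`-invariant metric. (For `X = 0` this is a constant curve, and a geodesic.) -/
def IsEquigeodesicVector (X : Mat6) : Prop :=
  ∃ hX : X ∈ 𝔪, ∀ Λ : InvariantMetric, IsGeodesic Λ (orbit ⟨X, hX.1⟩)

/-- The equation `[X, ΛX]_𝔪 = 0` for every `SO(6)`-invariant metric `Λ`. -/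
def EquigeodesicEquation (X : 𝔪) : Prop :=
  ∀ Λ : InvariantMetric, proj ⁅(X : Mat6), (Λ.op X : Mat6)⁆ = 0

/-- `X` is trivial if it lies in one of the modules `𝔪₁₂`, `𝔪₁₃`, `𝔪₂₃`. -/
def IsTrivial (X : Mat6) : Prop := X ∈ 𝔪12 ∨ X ∈ 𝔪13 ∨ X ∈ 𝔪23

/-! ### The coefficients, the system of equations, and the six families -/

/-- The coefficients of a vector of `𝔪` in the basis `ξ_{kl}`, in the usual numbering of the
indices from `1` to `6`. -/
structure Coeffs where
  (a12 a13 a14 a15 a16 a25 a26 a35 a36 a45 a46 : ℝ)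

/-- The vector `∑ a_{kl} ξ_{kl}`. -/
def Coeffs.vec (a : Coeffs) : Mat6 :=
  a.a12 • xi 0 1 + a.a13 • xi 0 2 + a.a14 • xi 0 3 + a.a15 • xi 0 4 + a.a16 • xi 0 5
    + a.a25 • xi 1 4 + a.a26 • xi 1 5 + a.a35 • xi 2 4 + a.a36 • xi 2 5
    + a.a45 • xi 3 4 + a.a46 • xi 3 5

theorem Coeffs.vec_mem_𝔪 (a : Coeffs) : a.vec ∈ 𝔪 := by
  have h : ∀ i j : Fin 6, blk i ≠ blk j → ∀ c : ℝ, c • xi i j ∈ 𝔪 := by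
    intro i j hij c
    refine 𝔪.smul_mem c (mem_𝔪_iff.2 ⟨xi_mem_so6 i j, fun k l hkl => ?_⟩)
    have h1 : ¬ (i = k ∧ j = l) := by rintro ⟨rfl, rfl⟩; exact hij hkl
    have h2 : ¬ (j = k ∧ i = l) := by rintro ⟨rfl, rfl⟩; exact hij hkl.symm
    simp [xi, h1, h2]
  unfold Coeffs.vec
  repeat' apply 𝔪.add_mem
  all_goals exact h _ _ (by decide) _

/-- The bilinear system for the coefficients of an equigeodesic vector. -/
def Coeffs.System (a : Coeffs) : Prop :=
  (a.a15 * a.a12 = 0 ∧ a.a15 * a.a13 = 0 ∧ a.a15 * a.a14 = 0 ∧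
    a.a16 * a.a12 = 0 ∧ a.a16 * a.a13 = 0 ∧ a.a16 * a.a14 = 0) ∧
  (a.a25 * a.a12 + a.a35 * a.a13 + a.a45 * a.a14 = 0 ∧
    a.a26 * a.a12 + a.a36 * a.a13 + a.a46 * a.a14 = 0) ∧
  (a.a25 * a.a15 + a.a26 * a.a16 = 0 ∧ a.a35 * a.a15 + a.a36 * a.a16 = 0 ∧
    a.a45 * a.a15 + a.a46 * a.a16 = 0)

def family1 : Set Mat6 :=
  {X | ∃ a12 a13 a14 a25 a26 a35 a36 : ℝ, a14 ≠ 0 ∧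
    X = a12 • xi 0 1 + a13 • xi 0 2 + a14 • xi 0 3 + a25 • xi 1 4 + a26 • xi 1 5
      + a35 • xi 2 4 + a36 • xi 2 5
      - ((a12 * a25 + a13 * a35) / a14) • xi 3 4 - ((a12 * a26 + a13 * a36) / a14) • xi 3 5}

def family2 : Set Mat6 :=
  {X | ∃ a12 a13 a25 a26 a45 a46 : ℝ, a13 ≠ 0 ∧
    X = a12 • xi 0 1 + a13 • xi 0 2 + a25 • xi 1 4 + a26 • xi 1 5
      + a45 • xi 3 4 + a46 • xi 3 5
      - (a12 * a25 / a13) • xi 2 4 - (a12 * a26 / a13) • xi 2 5}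

def family3 : Set Mat6 :=
  {X | ∃ a12 a35 a36 a45 a46 : ℝ,
    X = a12 • xi 0 1 + a35 • xi 2 4 + a36 • xi 2 5 + a45 • xi 3 4 + a46 • xi 3 5}

def family4 : Set Mat6 :=
  {X | ∃ a15 a16 a25 a35 a45 : ℝ, a16 ≠ 0 ∧
    X = a15 • xi 0 4 + a16 • xi 0 5 + a25 • xi 1 4 - (a15 * a25 / a16) • xi 1 5
      + a35 • xi 2 4 - (a15 * a35 / a16) • xi 2 5
      + a45 • xi 3 4 - (a15 * a45 / a16) • xi 3 5}

def family5 : Set Mat6 :=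
  {X | ∃ a15 a26 a36 a46 : ℝ,
    X = a15 • xi 0 4 + a26 • xi 1 5 + a36 • xi 2 5 + a46 • xi 3 5}

def family6 : Set Mat6 :=
  {X | ∃ a25 a26 a35 a36 a45 a46 : ℝ,
    X = a25 • xi 1 4 + a26 • xi 1 5 + a35 • xi 2 4 + a36 • xi 2 5
      + a45 • xi 3 4 + a46 • xi 3 5}

/-- The six families; `family 5` is the last one, `family6`. -/
def family : Fin 6 → Set Mat6 := ![family1, family2, family3, family4, family5, family6]

end Wallach

open Wallach

namespace Wallach

/-! ### Block diagonal rotations -/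

/-! Two independent facts reduce the theorem to linear algebra.

Invariant metrics are scalar on each of the three isotropy summands
(`InvariantMetric.coe_op_apply`), and any three positive scalars occur (`diagonalMetric`). This is
Schur's lemma made explicit: rotations inside a block lie in `H`, so `Λ` commutes with the
corresponding `ad ξ_{pq}` (`InvariantMetric.op_lie`); together with the `B`-symmetry of `Λ` this
kills all off-diagonal matrix coefficients and equates the diagonal ones within a summand. Symmetry
is essential, because the commutant of `SO(2)` on the plane contains a rotation. Entries of `[X,
ΛX]` are then differences of eigenvalues times the left sides of the system: the system makes the
whole bracket vanish for every metric, and one metric with three distinct eigenvalues recovers the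
system.

For a single metric, `exp(tX)·o` is a geodesic when `[X, ΛX] = 0`, and conversely. For a lift `F` of
a variation put `W = Fᵀ F_t` and `V = F_s Fᵀ`; then `W_s = Fᵀ V_t F`, so the first variation is `∫
⟨F (ΛW) Fᵀ, V_t⟩`. If `X` commutes with `ΛX` the momentum `F (ΛW) Fᵀ` is constant and only boundary
terms remain, which vanish for fixed end points (`isGeodesic_orbit`). Conversely, the variation
`exp(tX) exp(s t(1-t) Z)` with `Z = [X, ΛX]` has first variation `-|Z|²/6`
(`lie_eq_zero_of_isGeodesic`).

The equivalences close in a circle: equigeodesic, equation, system, equigeodesic. The six families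
come from solving the system according to which `a_{1l}` is nonzero. -/

theorem square_mem_H {A : SO6} (hA : IsBlockDiag (A : Mat6)) : A * A ∈ H := by
  refine ⟨hA.mul hA, fun k => ?_⟩
  -- Orthogonality passes to the diagonal blocks, so each block determinant squares to one; squaring
  -- `A` removes the sign.
  have h1 : ((A : Mat6).toSquareBlock blk k).det * ((A : Mat6)ᵀ.toSquareBlock blk k).det = 1 := by
    rw [← Matrix.det_mul, ← hA.toSquareBlock_mul, A.mul_transpose]
    exact (H.one_mem.2 k)
  have h2 : ((A : Mat6)ᵀ.toSquareBlock blk k).det = ((A : Mat6).toSquareBlock blk k).det := by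
    rw [← Matrix.det_transpose]
    rfl
  rw [SO6.coe_mul, hA.toSquareBlock_mul, Matrix.det_mul]
  rwa [h2] at h1

/-- The diagonal projection onto the coordinates `p` and `q`. -/
def planeProj (p q : Fin 6) : Mat6 := Matrix.single p p 1 + Matrix.single q q 1

/-- The rotation of the `(p, q)`-plane with cosine `c` and sine `s`. -/
def givens (p q : Fin 6) (c s : ℝ) : Mat6 := 1 + (c - 1) • planeProj p q + s • xi q p

theorem xi_transpose (p q : Fin 6) : (xi p q)ᵀ = -xi p q := by
  simp [xi]

theorem planeProj_mul_self {p q : Fin 6} (h : p ≠ q) :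
    planeProj p q * planeProj p q = planeProj p q := by
  simp [planeProj, mul_add, add_mul, h, h.symm]

theorem planeProj_mul_xi {p q : Fin 6} (h : p ≠ q) : planeProj p q * xi q p = xi q p := by
  simp [planeProj, xi, mul_sub, add_mul, h, h.symm]

theorem xi_mul_planeProj {p q : Fin 6} (h : p ≠ q) : xi q p * planeProj p q = xi q p := by
  simp [planeProj, xi, mul_add, sub_mul, h, h.symm]
  abel

theorem xi_mul_xi {p q : Fin 6} (h : p ≠ q) : xi q p * xi q p = -planeProj p q := by
  simp [planeProj, xi, mul_sub, sub_mul, h, h.symm]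
  abel

theorem givens_transpose (p q : Fin 6) (c s : ℝ) : (givens p q c s)ᵀ = givens p q c (-s) := by
  simp [givens, planeProj, xi_transpose]

theorem givens_mul {p q : Fin 6} (h : p ≠ q) (c s c' s' : ℝ) :
    givens p q c s * givens p q c' s' = givens p q (c * c' - s * s') (c * s' + s * c') := by
  simp only [givens, mul_add, add_mul, one_mul, mul_one, Matrix.smul_mul, Matrix.mul_smul,
    planeProj_mul_self h, planeProj_mul_xi h, xi_mul_planeProj h, xi_mul_xi h]
  module

theorem isBlockDiag_givens {p q : Fin 6} (h : blk p = blk q) (c s : ℝ) :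
    IsBlockDiag (givens p q c s) := by
  intro i j hij
  have h0 : i ≠ j := fun e => hij (e ▸ rfl)
  have h1 : ¬ (p = i ∧ p = j) := by rintro ⟨rfl, rfl⟩; exact hij rfl
  have h2 : ¬ (q = i ∧ q = j) := by rintro ⟨rfl, rfl⟩; exact hij rfl
  have h3 : ¬ (p = i ∧ q = j) := by rintro ⟨rfl, rfl⟩; exact hij h
  have h4 : ¬ (q = i ∧ p = j) := by rintro ⟨rfl, rfl⟩; exact hij h.symm
  simp [givens, planeProj, xi, h0, h1, h2, h3, h4]

theorem givens_mul_transpose {p q : Fin 6} (h : p ≠ q) {c s : ℝ} (hcs : c ^ 2 + s ^ 2 = 1) :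
    givens p q c s * (givens p q c s)ᵀ = 1 := by
  rw [givens_transpose, givens_mul h, show c * c - s * -s = 1 by linarith]
  simp [givens, mul_comm]

/-- The angle is quadrupled: the first doubling makes the determinant a square, hence one, which
gives an element of `SO(6)`; the second makes the block determinants one by `square_mem_H`. -/
theorem exists_mem_H_eq_givens {p q : Fin 6} (h : p ≠ q) (hb : blk p = blk q) {c s : ℝ}
    (hcs : c ^ 2 + s ^ 2 = 1) :
    ∃ g : H, ((g : SO6) : Mat6) = givens p q ((c ^ 2 - s ^ 2) ^ 2 - (2 * c * s) ^ 2)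
      (2 * (c ^ 2 - s ^ 2) * (2 * c * s)) := by
  have hA : givens p q (c ^ 2 - s ^ 2) (2 * c * s) ∈ Matrix.specialOrthogonalGroup (Fin 6) ℝ := by
    refine mem_SO6_iff.2 ⟨givens_mul_transpose h ?_, ?_⟩
    · linear_combination (c ^ 2 + s ^ 2 + 1) * hcs
    · have h1 := congrArg Matrix.det (givens_mul_transpose h hcs)
      rw [Matrix.det_mul, Matrix.det_transpose, Matrix.det_one] at h1
      rw [← h1, ← Matrix.det_mul, givens_mul h]
      congr 2 <;> ring
  refine ⟨⟨⟨_, hA⟩ * ⟨_, hA⟩, square_mem_H (isBlockDiag_givens hb _ _)⟩, ?_⟩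
  change givens p q _ _ * givens p q _ _ = _
  rw [givens_mul h]
  congr 1 <;> ring

/-! ### Invariant metrics are scalar on the isotropy summands -/

theorem apply_eq_neg (X : 𝔪) (i j : Fin 6) : (X : Mat6) i j = -(X : Mat6) j i :=
  mem_so6_iff.1 X.2.1 i j

theorem apply_eq_zero (X : 𝔪) {i j : Fin 6} (h : blk i = blk j) : (X : Mat6) i j = 0 :=
  (mem_𝔪_iff.1 X.2).2 i j h

theorem planeProj_mul_mul_planeProj {p q : Fin 6} (hb : blk p = blk q) (X : 𝔪) :
    planeProj p q * (X : Mat6) * planeProj p q = 0 := by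
  simp [planeProj, mul_add, add_mul, apply_eq_zero X rfl, apply_eq_zero X hb,
    apply_eq_zero X hb.symm]

/-- The terms even in `s` cancel. Among the odd ones, those containing both `planeProj` and `xi`
vanish because `X` has no entries inside a block. A finite difference thus gives the Lie algebra
action exactly, with no differentiation of the group action. -/
theorem givens_conj_sub {p q : Fin 6} (h : p ≠ q) (hb : blk p = blk q) (c s : ℝ) (X : 𝔪) :
    givens p q c s * (X : Mat6) * (givens p q c s)ᵀ
      - givens p q c (-s) * (X : Mat6) * (givens p q c (-s))ᵀ = (2 * s) • ⁅xi q p, (X : Mat6)⁆ := by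
  have h1 : xi q p * (X : Mat6) * planeProj p q = 0 := by
    rw [← xi_mul_planeProj h, mul_assoc, mul_assoc, ← mul_assoc (planeProj p q),
      planeProj_mul_mul_planeProj hb, mul_zero]
  have h2 : planeProj p q * (X : Mat6) * xi q p = 0 := by
    rw [← planeProj_mul_xi h, ← mul_assoc, planeProj_mul_mul_planeProj hb, zero_mul]
  simp only [givens_transpose, neg_neg, Ring.lie_def]
  simp only [givens, mul_add, add_mul, one_mul, mul_one, Matrix.smul_mul, Matrix.mul_smul, h1, h2]
  module

theorem InvariantMetric.op_lie (Λ : InvariantMetric) {p q : Fin 6} (h : p ≠ q)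
    (hb : blk p = blk q) (X Y : 𝔪) (hY : (Y : Mat6) = ⁅xi q p, (X : Mat6)⁆) :
    (Λ.op Y : Mat6) = ⁅xi q p, (Λ.op X : Mat6)⁆ := by
  -- A rational angle from the triple 3, 4, 5, whose quadruple has nonzero sine; the opposite angle
  -- has the same cosine.
  obtain ⟨g, hg⟩ := exists_mem_H_eq_givens h hb (c := 4 / 5) (s := 3 / 5) (by norm_num)
  obtain ⟨g', hg'⟩ := exists_mem_H_eq_givens h hb (c := 4 / 5) (s := -(3 / 5)) (by norm_num)
  set c : ℝ := ((4 / 5) ^ 2 - (3 / 5) ^ 2) ^ 2 - (2 * (4 / 5) * (3 / 5)) ^ 2 with hc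
  set s : ℝ := 2 * ((4 / 5) ^ 2 - (3 / 5) ^ 2) * (2 * (4 / 5) * (3 / 5)) with hs
  have hs0 : 2 * s ≠ 0 := by norm_num [hs]
  have hg'' : ((g' : SO6) : Mat6) = givens p q c (-s) := by
    rw [hg']; congr 1 <;> norm_num [hc, hs]
  have key : ∀ Z : 𝔪, ((Ad g Z - Ad g' Z : 𝔪) : Mat6) = (2 * s) • ⁅xi q p, (Z : Mat6)⁆ := by
    intro Z
    rw [← givens_conj_sub h hb c s Z, ← hg, ← hg'']
    rfl
  have h1 : Ad g X - Ad g' X = (2 * s) • Y := by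
    apply Subtype.ext
    rw [key X, ← hY]; rfl
  have h2 : (2 * s) • Λ.op Y = Ad g (Λ.op X) - Ad g' (Λ.op X) := by
    rw [← map_smul, ← h1, map_sub, Λ.equivariant, Λ.equivariant]
  have h3 := congrArg (Subtype.val) h2
  rw [key] at h3
  exact smul_right_injective _ hs0 h3

/-! ### Matrix coefficients of an invariant metric -/

theorem xi_mem_𝔪 {i j : Fin 6} (h : blk i ≠ blk j) : xi i j ∈ 𝔪 := by
  refine mem_𝔪_iff.2 ⟨xi_mem_so6 i j, fun k l hkl => ?_⟩
  have h1 : ¬ (i = k ∧ j = l) := by rintro ⟨rfl, rfl⟩; exact h hkl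
  have h2 : ¬ (j = k ∧ i = l) := by rintro ⟨rfl, rfl⟩; exact h hkl.symm
  simp [xi, h1, h2]

theorem xi_apply (a b i j : Fin 6) :
    xi a b i j = (if a = i ∧ b = j then 1 else 0) - (if b = i ∧ a = j then 1 else 0) := by
  simp [xi, Matrix.single_apply]

theorem lie_xi_apply (p q : Fin 6) (X : Mat6) (i j : Fin 6) :
    ⁅xi p q, X⁆ i j = (if i = p then X q j else 0) - (if i = q then X p j else 0)
      - (if j = q then X i p else 0) + (if j = p then X i q else 0) := by
  have h1 : ∀ a b : Fin 6, (Matrix.single a b (1 : ℝ) * X) i j = if i = a then X b j else 0 := by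
    intro a b
    split_ifs with h
    · subst h; simp
    · simp [h]
  have h2 : ∀ a b : Fin 6, (X * Matrix.single a b (1 : ℝ)) i j = if j = b then X i a else 0 := by
    intro a b
    split_ifs with h
    · subst h; simp
    · simp [h]
  simp only [Ring.lie_def, xi, mul_sub, sub_mul, Matrix.sub_apply, h1, h2]
  ring

/-- The matrix coefficients of an invariant metric in the basis of the `ξ_{ij}`. -/
noncomputable def InvariantMetric.coeff (Λ : InvariantMetric) (k l i j : Fin 6) : ℝ :=
  (Λ.op (proj (xi k l)) : Mat6) i j

theorem coe_proj_xi {i j : Fin 6} (h : blk i ≠ blk j) : (proj (xi i j) : Mat6) = xi i j :=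
  congrArg Subtype.val (proj_of_mem_𝔪 ⟨xi i j, xi_mem_𝔪 h⟩)

theorem B_xi (X : 𝔪) (i j : Fin 6) : B X (xi i j) = 2 * (X : Mat6) i j := by
  have := apply_eq_neg X i j
  simp only [B, xi, mul_sub, Matrix.trace_sub, Matrix.trace_mul_single]
  simp
  linarith

theorem B_comm (X Y : Mat6) : B X Y = B Y X := by
  rw [B, B, Matrix.trace_mul_comm]

namespace InvariantMetric

variable (Λ : InvariantMetric)

theorem coeff_symm {k l i j : Fin 6} (h : blk k ≠ blk l) (h' : blk i ≠ blk j) :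
    Λ.coeff k l i j = Λ.coeff i j k l := by
  have := Λ.symm (proj (xi k l)) (proj (xi i j))
  rw [coe_proj_xi h, coe_proj_xi h', B_comm (xi k l), B_xi, B_xi] at this
  simp only [coeff]
  linarith

theorem coeff_neg_right (k l i j : Fin 6) : Λ.coeff k l i j = -Λ.coeff k l j i :=
  apply_eq_neg _ _ _

theorem coeff_neg_left {k l : Fin 6} (h : blk k ≠ blk l) (i j : Fin 6) :
    Λ.coeff k l i j = -Λ.coeff l k i j := by
  by_cases h' : blk i = blk j
  · simp [coeff, apply_eq_zero _ h']
  · rw [Λ.coeff_symm h h', coeff_neg_right, Λ.coeff_symm h.symm h']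

/-- Since `ξ_{pl} = [ξ_{pq}, ξ_{ql}]`, the operator can be moved past `ad ξ_{pq}`. -/
theorem coeff_rotate {p q l : Fin 6} (h : p ≠ q) (hb : blk p = blk q) (hl : blk q ≠ blk l)
    (i j : Fin 6) :
    Λ.coeff p l i j = ⁅xi p q, (Λ.op (proj (xi q l)) : Mat6)⁆ i j := by
  rw [← Λ.op_lie h.symm hb.symm (proj (xi q l)) (proj (xi p l)), coeff]
  rw [coe_proj_xi hl, coe_proj_xi (hb ▸ hl)]
  have h1 : l ≠ p := by rintro rfl; exact hl hb.symm
  have h2 : l ≠ q := by rintro rfl; exact hl rfl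
  simp [xi, Ring.lie_def, mul_sub, sub_mul, h, h.symm, h1, h2, h1.symm, h2.symm]

/-- With disjoint indices `ξ_{pq}` commutes with `ξ_{kl}`, hence with its image under `Λ`; the `(p,
j)` entry of this vanishing bracket is the coefficient in question. -/
theorem coeff_eq_zero_of_disjoint {p q k l j : Fin 6} (h : p ≠ q) (hb : blk p = blk q)
    (hkl : blk k ≠ blk l) (hk : k ≠ p ∧ k ≠ q) (hl : l ≠ p ∧ l ≠ q) (hj : j ≠ p ∧ j ≠ q) :
    Λ.coeff k l q j = 0 := by
  have h0 := Λ.op_lie h.symm hb.symm (proj (xi k l)) 0 (by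
    rw [coe_proj_xi hkl]
    simp [xi, Ring.lie_def, mul_sub, sub_mul, hk.1, hk.2, hl.1, hl.2, hk.1.symm, hk.2.symm,
      hl.1.symm, hl.2.symm])
  have h1 := congrFun (congrFun h0 p) j
  rw [lie_xi_apply] at h1
  simpa [h, hj.1, hj.2, coeff] using h1.symm

theorem coeff_diag {p q l : Fin 6} (h : p ≠ q) (hb : blk p = blk q) (hl : blk q ≠ blk l) :
    Λ.coeff p l p l = Λ.coeff q l q l := by
  have h1 : l ≠ p := by rintro rfl; exact hl hb.symm
  have h2 : l ≠ q := by rintro rfl; exact hl rfl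
  rw [Λ.coeff_rotate h hb hl, lie_xi_apply]
  simp [h, h1, h2, coeff]

/-- The rotation makes this coefficient antisymmetric in `p` and `q`, while the symmetry of `Λ`
makes it symmetric. -/
theorem coeff_eq_zero_of_line {p q l : Fin 6} (h : p ≠ q) (hb : blk p = blk q)
    (hl : blk q ≠ blk l) : Λ.coeff p l q l = 0 := by
  have h1 : l ≠ p := by rintro rfl; exact hl hb.symm
  have h2 : l ≠ q := by rintro rfl; exact hl rfl
  have h3 : Λ.coeff p l q l = -Λ.coeff q l p l := by
    rw [Λ.coeff_rotate h hb hl, lie_xi_apply]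
    simp [h.symm, h1, h2, coeff]
  rw [Λ.coeff_symm hl (hb ▸ hl)] at h3
  linarith

end InvariantMetric

set_option synthInstance.maxHeartbeats 400000 in
set_option synthInstance.maxSize 4096 in
theorem index_cases : ∀ k l i j : Fin 6, blk k ≠ blk l → blk i ≠ blk j → ¬(k = i ∧ l = j) →
    ¬(k = j ∧ l = i) →
    (∃ p, p ≠ i ∧ blk p = blk i ∧ (k ≠ p ∧ k ≠ i) ∧ (l ≠ p ∧ l ≠ i)) ∨
    (∃ p, p ≠ j ∧ blk p = blk j ∧ (k ≠ p ∧ k ≠ j) ∧ (l ≠ p ∧ l ≠ j)) ∨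
    (∃ p, p ≠ k ∧ blk p = blk k ∧ (i ≠ p ∧ i ≠ k) ∧ (j ≠ p ∧ j ≠ k)) ∨
    (∃ p, p ≠ l ∧ blk p = blk l ∧ (i ≠ p ∧ i ≠ l) ∧ (j ≠ p ∧ j ≠ l)) ∨
    (l = j ∧ k ≠ i ∧ blk k = blk i) ∨ (l = i ∧ k ≠ j ∧ blk k = blk j) ∨
    (k = j ∧ l ≠ i ∧ blk l = blk i) ∨ (k = i ∧ l ≠ j ∧ blk l = blk j) := by
  decide +kernel

namespace InvariantMetric

variable (Λ : InvariantMetric)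

theorem coeff_offdiag {k l i j : Fin 6} (hkl : blk k ≠ blk l) (hij : blk i ≠ blk j)
    (h1 : ¬(k = i ∧ l = j)) (h2 : ¬(k = j ∧ l = i)) : Λ.coeff k l i j = 0 := by
  have ne : ∀ {p a b : Fin 6}, blk a ≠ blk b → blk p = blk a → b ≠ p ∧ b ≠ a := by
    intro p a b hab hp
    exact ⟨fun e => hab (by rw [e, hp]), fun e => hab (by rw [e])⟩
  rcases index_cases k l i j hkl hij h1 h2 with ⟨p, hp, hb, hk, hl⟩ | ⟨p, hp, hb, hk, hl⟩ |
    ⟨p, hp, hb, hk, hl⟩ | ⟨p, hp, hb, hk, hl⟩ | ⟨rfl, h, hb⟩ | ⟨rfl, h, hb⟩ | ⟨rfl, h, hb⟩ |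
    ⟨rfl, h, hb⟩
  · exact Λ.coeff_eq_zero_of_disjoint hp hb hkl hk hl (ne hij hb)
  · rw [coeff_neg_right, Λ.coeff_eq_zero_of_disjoint hp hb hkl hk hl (ne hij.symm hb), neg_zero]
  · rw [Λ.coeff_symm hkl hij, Λ.coeff_eq_zero_of_disjoint hp hb hij hk hl (ne hkl hb)]
  · rw [Λ.coeff_symm hkl hij, coeff_neg_right,
      Λ.coeff_eq_zero_of_disjoint hp hb hij hk hl (ne hkl.symm hb), neg_zero]
  · exact Λ.coeff_eq_zero_of_line h hb hij
  · rw [coeff_neg_right, Λ.coeff_eq_zero_of_line h hb hij.symm, neg_zero]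
  · rw [Λ.coeff_neg_left hkl, Λ.coeff_eq_zero_of_line h hb hij, neg_zero]
  · rw [Λ.coeff_neg_left hkl, coeff_neg_right, Λ.coeff_eq_zero_of_line h hb hij.symm, neg_zero,
      neg_zero]

/-- The eigenvalue of an invariant metric on the summand of the blocks `α` and `β`. -/
noncomputable def scalar (α β : Fin 3) : ℝ :=
  Λ.coeff (![0, 1, 4] α) (![0, 1, 4] β) (![0, 1, 4] α) (![0, 1, 4] β)

theorem coeff_self_comm {i j : Fin 6} (h : blk i ≠ blk j) :
    Λ.coeff i j i j = Λ.coeff j i j i := by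
  rw [Λ.coeff_neg_left h, coeff_neg_right, neg_neg]

theorem scalar_comm (α β : Fin 3) : Λ.scalar α β = Λ.scalar β α := by
  have hb : ∀ γ : Fin 3, blk (![0, 1, 4] γ) = γ := by decide
  by_cases h : α = β
  · rw [h]
  · exact Λ.coeff_self_comm (by rwa [hb, hb])

/-- Each index is moved within its block, by `coeff_diag`, to the first index of that block. -/
theorem coeff_self {i j : Fin 6} (h : blk i ≠ blk j) :
    Λ.coeff i j i j = Λ.scalar (blk i) (blk j) := by
  have hb : ∀ γ : Fin 3, blk (![0, 1, 4] γ) = γ := by decide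
  have move : ∀ {p q l : Fin 6}, blk p = blk q → blk q ≠ blk l →
      Λ.coeff p l p l = Λ.coeff q l q l := by
    intro p q l hpq hl
    by_cases e : p = q
    · rw [e]
    · exact Λ.coeff_diag e hpq hl
  rw [scalar, move (hb (blk i)).symm (by rwa [hb]), Λ.coeff_self_comm (by rwa [hb]),
    move (hb (blk j)).symm (by rw [hb, hb]; exact h.symm),
    Λ.coeff_self_comm (by rw [hb, hb]; exact h.symm)]

theorem coe_op_xi {i j : Fin 6} (h : blk i ≠ blk j) :
    (Λ.op (proj (xi i j)) : Mat6) = Λ.scalar (blk i) (blk j) • xi i j := by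
  ext k l
  change Λ.coeff i j k l = _
  rw [Matrix.smul_apply, smul_eq_mul]
  by_cases hkl : blk k = blk l
  · rw [coeff, apply_eq_zero _ hkl, ← coe_proj_xi h, apply_eq_zero _ hkl, mul_zero]
  have hij : i ≠ j := fun e => h (e ▸ rfl)
  rw [xi_apply]
  by_cases h1 : i = k ∧ j = l
  · obtain ⟨rfl, rfl⟩ := h1
    simp [hij, Λ.coeff_self h]
  by_cases h2 : j = k ∧ i = l
  · obtain ⟨rfl, rfl⟩ := h2
    rw [coeff_neg_right]
    simp [hij, Λ.coeff_self h]
  rw [Λ.coeff_offdiag h hkl h1 (fun e => h2 ⟨e.2, e.1⟩), if_neg h1, if_neg h2]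
  simp

theorem coe_op_apply (X : 𝔪) (i j : Fin 6) :
    (Λ.op X : Mat6) i j = Λ.scalar (blk i) (blk j) * (X : Mat6) i j := by
  by_cases h : blk i = blk j
  · rw [apply_eq_zero _ h, apply_eq_zero _ h, mul_zero]
  -- An entry of `ΛX` is half its pairing with `ξ_{ij}`; symmetry moves `Λ` onto this eigenvector.
  have h1 := Λ.symm X (proj (xi i j))
  rw [coe_op_xi _ h, coe_proj_xi h, B_xi] at h1
  have h2 : B X (Λ.scalar (blk i) (blk j) • xi i j) = Λ.scalar (blk i) (blk j) * B X (xi i j) := by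
    simp [B]
  rw [h2, B_xi] at h1
  linarith

end InvariantMetric

/-! ### Metrics given by scalars on the blocks -/

/-- Multiplication of the blocks of a matrix by scalars. -/
def blockScale (c : Fin 3 → Fin 3 → ℝ) (X : Mat6) : Mat6 :=
  Matrix.of fun i j => c (blk i) (blk j) * X i j

theorem blockScale_apply (c : Fin 3 → Fin 3 → ℝ) (X : Mat6) (i j : Fin 6) :
    blockScale c X i j = c (blk i) (blk j) * X i j := rfl

theorem IsBlockDiag.mul_blockScale {A : Mat6} (hA : IsBlockDiag A) (c : Fin 3 → Fin 3 → ℝ)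
    (X : Mat6) : blockScale c (A * X) = A * blockScale c X := by
  ext i j
  simp only [blockScale_apply, Matrix.mul_apply, Finset.mul_sum]
  refine Finset.sum_congr rfl fun k _ => ?_
  by_cases h : blk i = blk k
  · rw [h]; ring
  · rw [hA i k h]; ring

theorem IsBlockDiag.blockScale_mul {A : Mat6} (hA : IsBlockDiag A) (c : Fin 3 → Fin 3 → ℝ)
    (X : Mat6) : blockScale c (X * A) = blockScale c X * A := by
  ext i j
  simp only [blockScale_apply, Matrix.mul_apply, Finset.mul_sum]
  refine Finset.sum_congr rfl fun k _ => ?_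
  by_cases h : blk k = blk j
  · rw [h]; ring
  · rw [hA k j h]; ring

theorem blockScale_mem_𝔪 {c : Fin 3 → Fin 3 → ℝ} (hc : ∀ α β, c α β = c β α) {X : Mat6}
    (hX : X ∈ 𝔪) : blockScale c X ∈ 𝔪 := by
  obtain ⟨h1, h2⟩ := mem_𝔪_iff.1 hX
  refine mem_𝔪_iff.2 ⟨mem_so6_iff.2 fun i j => ?_, fun i j hij => ?_⟩
  · rw [blockScale_apply, blockScale_apply, hc, mem_so6_iff.1 h1 i j, mul_neg]
  · rw [blockScale_apply, h2 i j hij, mul_zero]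

theorem B_of_mem_so6 (X : Mat6) {Y : Mat6} (hY : Y ∈ so6) :
    B X Y = ∑ i, ∑ j, X i j * Y i j := by
  simp only [B, Matrix.trace, Matrix.diag, Matrix.mul_apply, ← Finset.sum_neg_distrib]
  refine Finset.sum_congr rfl fun i _ => Finset.sum_congr rfl fun j _ => ?_
  rw [mem_so6_iff.1 hY j i]
  ring

/-- The invariant metric with given positive eigenvalues on the isotropy summands. -/
def diagonalMetric (c : Fin 3 → Fin 3 → ℝ) (hc : ∀ α β, c α β = c β α)
    (hpos : ∀ α β, 0 < c α β) : InvariantMetric where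
  op :=
    { toFun := fun X => ⟨blockScale c X, blockScale_mem_𝔪 hc X.2⟩
      map_add' := fun X Y => by
        ext i j
        exact mul_add (c (blk i) (blk j)) ((X : Mat6) i j) ((Y : Mat6) i j)
      map_smul' := fun r X => by
        ext i j
        exact mul_left_comm (c (blk i) (blk j)) r ((X : Mat6) i j) }
  symm := fun X Y => by
    refine (B_of_mem_so6 _ Y.2.1).trans
      (Eq.trans ?_ (B_of_mem_so6 _ (blockScale_mem_𝔪 hc Y.2).1).symm)
    refine Finset.sum_congr rfl fun i _ => Finset.sum_congr rfl fun j _ => ?_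
    change c (blk i) (blk j) * _ * _ = _ * (c (blk i) (blk j) * _)
    ring
  pos := fun X hX => by
    rw [B_of_mem_so6 _ X.2.1]
    have h0 : ∀ i j, 0 ≤ blockScale c X i j * (X : Mat6) i j := fun i j => by
      rw [blockScale_apply, mul_assoc]
      exact mul_nonneg (hpos _ _).le (mul_self_nonneg _)
    have hne : ∃ i j, (X : Mat6) i j ≠ 0 := by
      by_contra! h
      exact hX (by ext i j; exact h i j)
    obtain ⟨i, j, hij⟩ := hne
    refine Finset.sum_pos' (fun i _ => Finset.sum_nonneg fun j _ => h0 i j)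
      ⟨i, Finset.mem_univ _, Finset.sum_pos' (fun j _ => h0 i j) ⟨j, Finset.mem_univ _, ?_⟩⟩
    change 0 < c (blk i) (blk j) * _ * _
    rw [mul_assoc]
    exact mul_pos (hpos _ _) (mul_self_pos.2 hij)
  equivariant := fun h X => by
    apply Subtype.ext
    change blockScale c (((h : SO6) : Mat6) * X * ((h : SO6) : Mat6)ᵀ) =
      ((h : SO6) : Mat6) * blockScale c X * ((h : SO6) : Mat6)ᵀ
    rw [h.2.1.transpose.blockScale_mul, h.2.1.mul_blockScale]

theorem InvariantMetric.coe_op (Λ : InvariantMetric) (X : 𝔪) :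
    (Λ.op X : Mat6) = blockScale Λ.scalar X := by
  ext i j
  exact Λ.coe_op_apply X i j

/-! ### The bilinear system -/

theorem Coeffs.vec_eq (a : Coeffs) : a.vec =
    !![0, a.a12, a.a13, a.a14, a.a15, a.a16;
      -a.a12, 0, 0, 0, a.a25, a.a26;
      -a.a13, 0, 0, 0, a.a35, a.a36;
      -a.a14, 0, 0, 0, a.a45, a.a46;
      -a.a15, -a.a25, -a.a35, -a.a45, 0, 0;
      -a.a16, -a.a26, -a.a36, -a.a46, 0, 0] := by
  ext i j
  fin_cases i <;> fin_cases j <;> simp [Coeffs.vec, xi_apply]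

theorem exists_coeffs {X : Mat6} (hX : X ∈ 𝔪) : ∃ a : Coeffs, a.vec = X := by
  refine ⟨⟨X 0 1, X 0 2, X 0 3, X 0 4, X 0 5, X 1 4, X 1 5, X 2 4, X 2 5, X 3 4, X 3 5⟩, ?_⟩
  have h1 := apply_eq_neg ⟨X, hX⟩
  have h2 := fun i j => @apply_eq_zero ⟨X, hX⟩ i j
  rw [Coeffs.vec_eq]
  ext i j
  fin_cases i <;> fin_cases j <;>
    first
    | rfl
    | exact (h2 _ _ (by decide)).symm
    | exact (h1 _ _).symm

/-- For `X` in `𝔪` and symmetric `c`, the factor vanishes when `i` and `j` share a block; otherwise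
only `k` in the third block contributes, with a factor independent of `k`. -/
theorem lie_blockScale_apply (c : Fin 3 → Fin 3 → ℝ) (X : Mat6) (i j : Fin 6) :
    ⁅X, blockScale c X⁆ i j =
      ∑ k, (c (blk k) (blk j) - c (blk i) (blk k)) * (X i k * X k j) := by
  rw [Ring.lie_def, Matrix.sub_apply, Matrix.mul_apply, Matrix.mul_apply, ← Finset.sum_sub_distrib]
  refine Finset.sum_congr rfl fun k _ => ?_
  rw [blockScale_apply, blockScale_apply]
  ring

/-- The full bracket vanishes, not just its `𝔪`-component; the geodesic criterion needs the
commutation of `X` with `ΛX`. -/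
theorem Coeffs.System.lie_eq_zero {a : Coeffs} (ha : a.System) {c : Fin 3 → Fin 3 → ℝ}
    (hc : ∀ α β, c α β = c β α) : ⁅a.vec, blockScale c a.vec⁆ = 0 := by
  obtain ⟨⟨h1, h2, h3, h4, h5, h6⟩, ⟨h7, h8⟩, h9, h10, h11⟩ := ha
  have e1 := hc 1 0
  have e2 := hc 2 0
  have e3 := hc 2 1
  ext i j
  rw [lie_blockScale_apply, Coeffs.vec_eq, Fin.sum_univ_six]
  fin_cases i <;> fin_cases j <;> simp [blk, e1, e2, e3] <;> grind

theorem EquigeodesicEquation.system {a : Coeffs}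
    (h : EquigeodesicEquation ⟨a.vec, a.vec_mem_𝔪⟩) : a.System := by
  -- Distinct eigenvalues 1, 2, 3 on `𝔪₁₂`, `𝔪₁₃`, `𝔪₂₃`, so that no eigenvalue difference is zero.
  -- The diagonal values play no role beyond positivity.
  let c : Fin 3 → Fin 3 → ℝ := ![![1, 1, 2], ![1, 1, 3], ![2, 3, 1]]
  have hc : ∀ α β, c α β = c β α := by
    intro α β
    fin_cases α <;> fin_cases β <;> rfl
  have hpos : ∀ α β, 0 < c α β := by
    intro α β
    fin_cases α <;> fin_cases β <;> norm_num [c]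
  have h1 : proj ⁅a.vec, blockScale c a.vec⁆ = 0 := h (diagonalMetric c hc hpos)
  have h2 : ∀ i j, blk i ≠ blk j →
      ⁅a.vec, blockScale c a.vec⁆ i j - ⁅a.vec, blockScale c a.vec⁆ j i = 0 := by
    intro i j hij
    have h3 := congrFun (congrFun (congrArg Subtype.val h1) i) j
    simp only [proj, Matrix.of_apply, if_neg hij] at h3
    have h4 : ((0 : 𝔪) : Mat6) i j = 0 := rfl
    linarith [h3.trans h4]
  simp only [lie_blockScale_apply, Coeffs.vec_eq, Fin.sum_univ_six] at h2
  have h01 := h2 0 1 (by decide)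
  have h02 := h2 0 2 (by decide)
  have h03 := h2 0 3 (by decide)
  have h04 := h2 0 4 (by decide)
  have h05 := h2 0 5 (by decide)
  have h14 := h2 1 4 (by decide)
  have h15 := h2 1 5 (by decide)
  have h24 := h2 2 4 (by decide)
  have h25 := h2 2 5 (by decide)
  have h34 := h2 3 4 (by decide)
  have h35 := h2 3 5 (by decide)
  clear h2 h1 h
  simp [blk, c] at h01 h02 h03 h04 h05 h14 h15 h24 h25 h34 h35
  refine ⟨⟨?_, ?_, ?_, ?_, ?_, ?_⟩, ⟨?_, ?_⟩, ?_, ?_, ?_⟩ <;> linarith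

/-! ### The six families -/

/-- The converse direction selects the first nonzero coefficient in the order `a14`, `a13`, `a12`,
`a16`, `a15`. A nonzero `a12`, `a13` or `a14` forces `a15 = a16 = 0`, and the remaining linear
equations are solved by dividing by the selected coefficient. -/
theorem exists_mem_family_iff {X : Mat6} :
    (∃ i, X ∈ family i) ↔ ∃ a : Coeffs, a.System ∧ a.vec = X := by
  constructor
  · rintro ⟨i, hi⟩
    fin_cases i
    · obtain ⟨a12, a13, a14, a25, a26, a35, a36, h0, rfl⟩ := hi
      refine ⟨⟨a12, a13, a14, 0, 0, a25, a26, a35, a36, -((a12 * a25 + a13 * a35) / a14),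
        -((a12 * a26 + a13 * a36) / a14)⟩, ?_, by simp only [Coeffs.vec]; module⟩
      simp only [Coeffs.System]
      refine ⟨by simp, ⟨?_, ?_⟩, by simp⟩ <;> field_simp <;> ring
    · obtain ⟨a12, a13, a25, a26, a45, a46, h0, rfl⟩ := hi
      refine ⟨⟨a12, a13, 0, 0, 0, a25, a26, -(a12 * a25 / a13), -(a12 * a26 / a13), a45, a46⟩,
        ?_, by simp only [Coeffs.vec]; module⟩
      simp only [Coeffs.System]
      refine ⟨by simp, ⟨?_, ?_⟩, by simp⟩ <;> field_simp <;> ring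
    · obtain ⟨a12, a35, a36, a45, a46, rfl⟩ := hi
      exact ⟨⟨a12, 0, 0, 0, 0, 0, 0, a35, a36, a45, a46⟩, by simp [Coeffs.System],
        by simp only [Coeffs.vec]; module⟩
    · obtain ⟨a15, a16, a25, a35, a45, h0, rfl⟩ := hi
      refine ⟨⟨0, 0, 0, a15, a16, a25, -(a15 * a25 / a16), a35, -(a15 * a35 / a16), a45,
        -(a15 * a45 / a16)⟩, ?_, by simp only [Coeffs.vec]; module⟩
      simp only [Coeffs.System]
      refine ⟨by simp, by simp, ?_, ?_, ?_⟩ <;> field_simp <;> ring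
    · obtain ⟨a15, a26, a36, a46, rfl⟩ := hi
      exact ⟨⟨0, 0, 0, a15, 0, 0, a26, 0, a36, 0, a46⟩, by simp [Coeffs.System],
        by simp only [Coeffs.vec]; module⟩
    · obtain ⟨a25, a26, a35, a36, a45, a46, rfl⟩ := hi
      exact ⟨⟨0, 0, 0, 0, 0, a25, a26, a35, a36, a45, a46⟩, by simp [Coeffs.System],
        by simp only [Coeffs.vec]; module⟩
  · rintro ⟨⟨a12, a13, a14, a15, a16, a25, a26, a35, a36, a45, a46⟩, ha, rfl⟩
    obtain ⟨⟨h1, h2, h3, h4, h5, h6⟩, ⟨h7, h8⟩, h9, h10, h11⟩ := ha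
    simp only at h1 h2 h3 h4 h5 h6 h7 h8 h9 h10 h11
    simp only [Coeffs.vec]
    by_cases e14 : a14 = 0
    swap
    · refine ⟨0, a12, a13, a14, a25, a26, a35, a36, e14, ?_⟩
      have k1 : a15 = 0 := (mul_eq_zero.1 h3).resolve_right e14
      have k2 : a16 = 0 := (mul_eq_zero.1 h6).resolve_right e14
      have k3 : (a12 * a25 + a13 * a35) / a14 = -a45 := by
        rw [div_eq_iff e14]; linarith
      have k4 : (a12 * a26 + a13 * a36) / a14 = -a46 := by
        rw [div_eq_iff e14]; linarith
      rw [k1, k2, k3, k4]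
      module
    subst e14
    by_cases e13 : a13 = 0
    swap
    · refine ⟨1, a12, a13, a25, a26, a45, a46, e13, ?_⟩
      have k1 : a15 = 0 := (mul_eq_zero.1 h2).resolve_right e13
      have k2 : a16 = 0 := (mul_eq_zero.1 h5).resolve_right e13
      have k3 : a12 * a25 / a13 = -a35 := by
        rw [div_eq_iff e13]; linarith
      have k4 : a12 * a26 / a13 = -a36 := by
        rw [div_eq_iff e13]; linarith
      rw [k1, k2, k3, k4]
      module
    subst e13
    by_cases e12 : a12 = 0
    swap
    · refine ⟨2, a12, a35, a36, a45, a46, ?_⟩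
      have k1 : a15 = 0 := (mul_eq_zero.1 h1).resolve_right e12
      have k2 : a16 = 0 := (mul_eq_zero.1 h4).resolve_right e12
      have k3 : a25 = 0 := by simpa [e12] using h7
      have k4 : a26 = 0 := by simpa [e12] using h8
      rw [k1, k2, k3, k4]
      module
    subst e12
    by_cases e16 : a16 = 0
    swap
    · refine ⟨3, a15, a16, a25, a35, a45, e16, ?_⟩
      have k1 : a15 * a25 / a16 = -a26 := by
        rw [div_eq_iff e16]; linarith
      have k2 : a15 * a35 / a16 = -a36 := by
        rw [div_eq_iff e16]; linarith
      have k3 : a15 * a45 / a16 = -a46 := by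
        rw [div_eq_iff e16]; linarith
      rw [k1, k2, k3]
      module
    subst e16
    by_cases e15 : a15 = 0
    swap
    · refine ⟨4, a15, a26, a36, a46, ?_⟩
      have k1 : a25 = 0 := by simpa [e15] using h9
      have k2 : a35 = 0 := by simpa [e15] using h10
      have k3 : a45 = 0 := by simpa [e15] using h11
      rw [k1, k2, k3]
      module
    subst e15
    refine ⟨5, a25, a26, a35, a36, a45, a46, ?_⟩
    module

/-! ### Independence of the six families -/

theorem apply_of_mem_family1 {X : Mat6} (h : X ∈ family1) : X 0 3 ≠ 0 := by
  obtain ⟨a12, a13, a14, a25, a26, a35, a36, h0, rfl⟩ := h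
  simpa [xi_apply] using h0

theorem apply_of_mem_family2 {X : Mat6} (h : X ∈ family2) : X 0 2 ≠ 0 ∧ X 0 3 = 0 := by
  obtain ⟨a12, a13, a25, a26, a45, a46, h0, rfl⟩ := h
  simpa [xi_apply] using h0

theorem apply_of_mem_family3 {X : Mat6} (h : X ∈ family3) :
    X 0 2 = 0 ∧ X 0 3 = 0 ∧ X 0 4 = 0 ∧ X 0 5 = 0 ∧ X 1 4 = 0 := by
  obtain ⟨a12, a35, a36, a45, a46, rfl⟩ := h
  simp [xi_apply]

theorem apply_of_mem_family4 {X : Mat6} (h : X ∈ family4) :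
    X 0 5 ≠ 0 ∧ X 0 1 = 0 ∧ X 0 2 = 0 ∧ X 0 3 = 0 := by
  obtain ⟨a15, a16, a25, a35, a45, h0, rfl⟩ := h
  simpa [xi_apply] using h0

theorem apply_of_mem_family5 {X : Mat6} (h : X ∈ family5) :
    X 0 1 = 0 ∧ X 0 2 = 0 ∧ X 0 3 = 0 ∧ X 0 5 = 0 ∧ X 1 4 = 0 := by
  obtain ⟨a15, a26, a36, a46, rfl⟩ := h
  simp [xi_apply]

theorem apply_of_mem_family6 {X : Mat6} (h : X ∈ family6) :
    X 0 1 = 0 ∧ X 0 2 = 0 ∧ X 0 3 = 0 ∧ X 0 4 = 0 ∧ X 0 5 = 0 := by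
  obtain ⟨a25, a26, a35, a36, a45, a46, rfl⟩ := h
  simp [xi_apply]

theorem family_independent (i : Fin 6) : ∃ X ∈ family i, ∀ j, j ≠ i → X ∉ family j := by
  have key : ∀ Y : Mat6, (∀ j, Y ∈ family j → j = i) → ∀ j, j ≠ i → Y ∉ family j :=
    fun Y h j hj hY => hj (h j hY)
  have cases : ∀ Y : Mat6, ∀ j, Y ∈ family j →
      (j = 0 ∧ Y ∈ family1) ∨ (j = 1 ∧ Y ∈ family2) ∨ (j = 2 ∧ Y ∈ family3) ∨
      (j = 3 ∧ Y ∈ family4) ∨ (j = 4 ∧ Y ∈ family5) ∨ (j = 5 ∧ Y ∈ family6) := by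
    intro Y j hj
    fin_cases j <;> simpa [family] using hj
  -- A single basis vector separates each family: `ξ₁₄, ξ₁₃, ξ₁₂, ξ₁₆, ξ₁₅` and `ξ₂₅`. For the last
  -- family `ξ₂₅` is the only choice among the basis vectors of `𝔪₂₃`, since the others occur in the
  -- third or the fifth family.
  have mem : xi (![0, 0, 0, 0, 0, 1] i) (![3, 2, 1, 5, 4, 4] i) ∈ family i := by
    fin_cases i
    · exact ⟨0, 0, 1, 0, 0, 0, 0, one_ne_zero, by simp⟩
    · exact ⟨0, 1, 0, 0, 0, 0, one_ne_zero, by simp⟩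
    · exact ⟨1, 0, 0, 0, 0, by simp⟩
    · exact ⟨0, 1, 0, 0, 0, one_ne_zero, by simp⟩
    · exact ⟨1, 0, 0, 0, by simp⟩
    · exact ⟨1, 0, 0, 0, 0, 0, by simp⟩
  refine ⟨_, mem, key _ fun j hj => ?_⟩
  rcases cases _ j hj with ⟨rfl, h⟩ | ⟨rfl, h⟩ | ⟨rfl, h⟩ | ⟨rfl, h⟩ | ⟨rfl, h⟩ | ⟨rfl, h⟩
  · have := apply_of_mem_family1 h
    fin_cases i <;> simp [xi_apply] at this ⊢
  · have := apply_of_mem_family2 h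
    fin_cases i <;> simp [xi_apply] at this ⊢
  · have := apply_of_mem_family3 h
    fin_cases i <;> simp [xi_apply] at this ⊢
  · have := apply_of_mem_family4 h
    fin_cases i <;> simp [xi_apply] at this ⊢
  · have := apply_of_mem_family5 h
    fin_cases i <;> simp [xi_apply] at this ⊢
  · have := apply_of_mem_family6 h
    fin_cases i <;> simp [xi_apply] at this ⊢

/-! ### Position of the families and trivial vectors -/

theorem xi_mem_𝔪sub (a b : Fin 6) : xi a b ∈ 𝔪sub (blk a) (blk b) :=
  Submodule.subset_span ⟨a, b, rfl, rfl, rfl⟩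

theorem of_mem_𝔪sub {α β : Fin 3} (h : α ≠ β) {X : Mat6} (hX : X ∈ 𝔪sub α β) :
    X ∈ 𝔪 ∧ ∀ i j, blk i ≠ α → blk j ≠ α → X i j = 0 := by
  induction hX using Submodule.span_induction with
  | mem X hX =>
    obtain ⟨a, b, rfl, rfl, rfl⟩ := hX
    refine ⟨xi_mem_𝔪 h, fun i j h1 h2 => ?_⟩
    have h3 : a ≠ i := fun e => h1 (e ▸ rfl)
    have h4 : a ≠ j := fun e => h2 (e ▸ rfl)
    simp [xi_apply, h3, h4]
  | zero => exact ⟨𝔪.zero_mem, fun _ _ _ _ => rfl⟩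
  | add X Y _ _ hX hY =>
    exact ⟨𝔪.add_mem hX.1 hY.1, fun i j h1 h2 => by simp [hX.2 i j h1 h2, hY.2 i j h1 h2]⟩
  | smul r X _ hX => exact ⟨𝔪.smul_mem r hX.1, fun i j h1 h2 => by simp [hX.2 i j h1 h2]⟩

theorem 𝔪sub_comm (α β : Fin 3) : 𝔪sub α β ≤ 𝔪sub β α := by
  refine Submodule.span_le.2 ?_
  rintro _ ⟨a, b, rfl, rfl, rfl⟩
  have : xi a b = -xi b a := by simp [xi]
  rw [SetLike.mem_coe, this]
  exact (𝔪sub _ _).neg_mem (xi_mem_𝔪sub b a)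

theorem of_mem_𝔪sub' {α β : Fin 3} (h : α ≠ β) {X : Mat6} (hX : X ∈ 𝔪sub α β) :
    ∀ i j, blk i ≠ β → blk j ≠ β → X i j = 0 :=
  (of_mem_𝔪sub h.symm (𝔪sub_comm α β hX)).2

theorem family6_subset : family6 ⊆ (𝔪23 : Set Mat6) := by
  rintro _ ⟨a25, a26, a35, a36, a45, a46, rfl⟩
  have h : ∀ i j c, blk i = 1 → blk j = 2 → c • xi i j ∈ 𝔪23 := fun i j c hi hj =>
    𝔪23.smul_mem c (by rw [𝔪23, ← hi, ← hj]; exact xi_mem_𝔪sub i j)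
  refine 𝔪23.add_mem (𝔪23.add_mem (𝔪23.add_mem (𝔪23.add_mem (𝔪23.add_mem ?_ ?_) ?_) ?_) ?_) ?_ <;>
    exact h _ _ _ rfl rfl

theorem family6_eq : family6 = (𝔪23 : Set Mat6) := by
  refine Set.Subset.antisymm family6_subset fun X hX => ?_
  have h := of_mem_𝔪sub' (by decide) hX
  have h0 := of_mem_𝔪sub (by decide) hX
  obtain ⟨a, rfl⟩ := exists_coeffs h0.1
  have h1 := h 0 1 (by decide) (by decide)
  have h2 := h 0 2 (by decide) (by decide)
  have h3 := h 0 3 (by decide) (by decide)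
  have h4 := h0.2 0 4 (by decide) (by decide)
  have h5 := h0.2 0 5 (by decide) (by decide)
  rw [Coeffs.vec_eq] at h1 h2 h3 h4 h5
  simp at h1 h2 h3 h4 h5
  refine ⟨a.a25, a.a26, a.a35, a.a36, a.a45, a.a46, ?_⟩
  rw [Coeffs.vec, h1, h2, h3, h4, h5]
  module

theorem smul_xi_mem_sup (c : ℝ) {i j : Fin 6} {α β γ δ : Fin 3}
    (h : (blk i = α ∧ blk j = β) ∨ (blk i = γ ∧ blk j = δ)) :
    c • xi i j ∈ 𝔪sub α β ⊔ 𝔪sub γ δ := by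
  rcases h with ⟨rfl, rfl⟩ | ⟨rfl, rfl⟩
  · exact Submodule.mem_sup_left ((𝔪sub _ _).smul_mem c (xi_mem_𝔪sub i j))
  · exact Submodule.mem_sup_right ((𝔪sub _ _).smul_mem c (xi_mem_𝔪sub i j))

theorem family_position :
    family1 ⊆ (𝔪12 ⊔ 𝔪23 : Submodule ℝ Mat6) ∧ family2 ⊆ (𝔪12 ⊔ 𝔪23 : Submodule ℝ Mat6) ∧
      family3 ⊆ (𝔪12 ⊔ 𝔪23 : Submodule ℝ Mat6) ∧
      family4 ⊆ (𝔪13 ⊔ 𝔪23 : Submodule ℝ Mat6) ∧ family5 ⊆ (𝔪13 ⊔ 𝔪23 : Submodule ℝ Mat6) := by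
  refine ⟨?_, ?_, ?_, ?_, ?_⟩
  · rintro _ ⟨a12, a13, a14, a25, a26, a35, a36, h0, rfl⟩
    repeat' first | refine Submodule.sub_mem _ ?_ ?_ | refine Submodule.add_mem _ ?_ ?_
    all_goals (apply smul_xi_mem_sup; decide)
  · rintro _ ⟨a12, a13, a25, a26, a45, a46, h0, rfl⟩
    repeat' first | refine Submodule.sub_mem _ ?_ ?_ | refine Submodule.add_mem _ ?_ ?_
    all_goals (apply smul_xi_mem_sup; decide)
  · rintro _ ⟨a12, a35, a36, a45, a46, rfl⟩
    repeat' refine Submodule.add_mem _ ?_ ?_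
    all_goals (apply smul_xi_mem_sup; decide)
  · rintro _ ⟨a15, a16, a25, a35, a45, h0, rfl⟩
    repeat' first | refine Submodule.sub_mem _ ?_ ?_ | refine Submodule.add_mem _ ?_ ?_
    all_goals (apply smul_xi_mem_sup; decide)
  · rintro _ ⟨a15, a26, a36, a46, rfl⟩
    repeat' refine Submodule.add_mem _ ?_ ?_
    all_goals (apply smul_xi_mem_sup; decide)

/-- A trivial vector cannot have non-zero entries in two different isotropy summands. -/
theorem IsTrivial.mul_eq_zero {X : Mat6} (h : IsTrivial X) {i j k l : Fin 6} (hi : blk i = 0)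
    (hj : blk j ≠ 0) (hk : blk k = 1) (hl : blk l = 2) : X i j * X k l = 0 := by
  rcases h with h | h | h
  · rw [(of_mem_𝔪sub (by decide) h).2 k l (by rw [hk]; decide) (by rw [hl]; decide), mul_zero]
  · rw [(of_mem_𝔪sub (by decide) h).2 k l (by rw [hk]; decide) (by rw [hl]; decide), mul_zero]
  · have hj' : blk j = 1 ∨ blk j = 2 := by
      revert hj; generalize blk j = β; revert β; decide
    rcases hj' with hj' | hj'
    · rw [of_mem_𝔪sub' (by decide) h i j (by rw [hi]; decide) (by rw [hj']; decide), zero_mul]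
    · rw [(of_mem_𝔪sub (by decide) h).2 i j (by rw [hi]; decide) (by rw [hj']; decide), zero_mul]

theorem family_trivial_iff (i : Fin 6) : (∀ X ∈ family i, IsTrivial X) ↔ i = 5 := by
  constructor
  · intro h
    fin_cases i
    -- In each of the first five families the witness has a nonzero entry in the first row and
    -- another one in `𝔪₂₃`.
    · have := (h _ ⟨0, 0, 1, 1, 0, 0, 0, one_ne_zero, rfl⟩).mul_eq_zero (i := 0) (j := 3) (k := 1)
        (l := 4) rfl (by decide) rfl rfl
      simp [xi_apply] at this
    · have := (h _ ⟨0, 1, 1, 0, 0, 0, one_ne_zero, rfl⟩).mul_eq_zero (i := 0) (j := 2) (k := 1)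
        (l := 4) rfl (by decide) rfl rfl
      simp [xi_apply] at this
    · have := (h _ ⟨1, 1, 0, 0, 0, rfl⟩).mul_eq_zero (i := 0) (j := 1) (k := 2)
        (l := 4) rfl (by decide) rfl rfl
      simp [xi_apply] at this
    · have := (h _ ⟨0, 1, 1, 0, 0, one_ne_zero, rfl⟩).mul_eq_zero (i := 0) (j := 5) (k := 1)
        (l := 4) rfl (by decide) rfl rfl
      simp [xi_apply] at this
    · have := (h _ ⟨1, 1, 0, 0, rfl⟩).mul_eq_zero (i := 0) (j := 4) (k := 1)
        (l := 5) rfl (by decide) rfl rfl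
      simp [xi_apply] at this
    · rfl
  · rintro rfl X hX
    exact Or.inr (Or.inr (family6_subset hX))

/-! ### Entrywise calculus of matrix-valued maps -/

/-- The matrix-valued curve `A` has derivative `A'` at `t`, entry by entry. -/
def HasMatDerivAt (A : ℝ → Mat6) (A' : Mat6) (t : ℝ) : Prop :=
  ∀ i j, HasDerivAt (fun r => A r i j) (A' i j) t

namespace HasMatDerivAt

variable {A C : ℝ → Mat6} {A' C' : Mat6} {t : ℝ}

theorem mul (hA : HasMatDerivAt A A' t) (hC : HasMatDerivAt C C' t) :
    HasMatDerivAt (fun r => A r * C r) (A' * C t + A t * C') t := by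
  intro i j
  simp only [Matrix.mul_apply, Matrix.add_apply, ← Finset.sum_add_distrib]
  exact HasDerivAt.fun_sum fun k _ => (hA i k).mul (hC k j)

theorem transpose (hA : HasMatDerivAt A A' t) : HasMatDerivAt (fun r => (A r)ᵀ) A'ᵀ t :=
  fun i j => hA j i

theorem add (hA : HasMatDerivAt A A' t) (hC : HasMatDerivAt C C' t) :
    HasMatDerivAt (fun r => A r + C r) (A' + C') t :=
  fun i j => (hA i j).add (hC i j)

theorem smul {u : ℝ → ℝ} {u' : ℝ} (hu : HasDerivAt u u' t) (hA : HasMatDerivAt A A' t) :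
    HasMatDerivAt (fun r => u r • A r) (u' • A t + u t • A') t :=
  fun i j => hu.mul (hA i j)

theorem scomp {u : ℝ → ℝ} {u' : ℝ} (hA : HasMatDerivAt A A' (u t)) (hu : HasDerivAt u u' t) :
    HasMatDerivAt (fun r => A (u r)) (u' • A') t := by
  intro i j
  have := (hA i j).comp t hu
  rw [Matrix.smul_apply, smul_eq_mul, mul_comm]
  exact this

theorem unique (hA : HasMatDerivAt A A' t) (hC : HasMatDerivAt A C' t) : A' = C' := by
  ext i j
  exact (hA i j).unique (hC i j)

theorem congr (hA : HasMatDerivAt A A' t) (h : ∀ r, C r = A r) : HasMatDerivAt C A' t := by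
  rwa [show C = A from funext h]

/-- The derivative of a curve of block diagonal matrices is block diagonal. -/
theorem isBlockDiag (hA : HasMatDerivAt A A' t) (h : ∀ᶠ r in nhds t, IsBlockDiag (A r)) :
    IsBlockDiag A' := by
  intro i j hij
  refine (hA i j).unique ((hasDerivAt_const t (0 : ℝ)).congr_of_eventuallyEq ?_)
  filter_upwards [h] with r hr using hr i j hij

end HasMatDerivAt

theorem hasMatDerivAt_const (A : Mat6) (t : ℝ) : HasMatDerivAt (fun _ => A) 0 t :=
  fun _ _ => hasDerivAt_const _ _

/-- Entrywise smoothness of a two-parameter family of matrices. -/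
def IsSmoothMat (A : ℝ × ℝ → Mat6) : Prop := ∀ i j, ContDiff ℝ ∞ fun p => A p i j

/-- The entrywise derivative in the direction `v`. -/
noncomputable def dirDeriv (v : ℝ × ℝ) (A : ℝ × ℝ → Mat6) (p : ℝ × ℝ) : Mat6 :=
  Matrix.of fun i j => fderiv ℝ (fun q => A q i j) p v

namespace IsSmoothMat

variable {A C : ℝ × ℝ → Mat6}

theorem mul (hA : IsSmoothMat A) (hC : IsSmoothMat C) : IsSmoothMat fun p => A p * C p := by
  intro i j
  simp only [Matrix.mul_apply]
  exact ContDiff.sum fun k _ => (hA i k).mul (hC k j)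

theorem transpose (hA : IsSmoothMat A) : IsSmoothMat fun p => (A p)ᵀ := fun i j => hA j i

theorem dirDeriv (hA : IsSmoothMat A) (v : ℝ × ℝ) : IsSmoothMat (dirDeriv v A) := by
  intro i j
  exact ((hA i j).fderiv_right (m := ∞) (by simp)).clm_apply contDiff_const

theorem hasDerivAt_fst {G : ℝ × ℝ → ℝ} (hG : ContDiff ℝ ∞ G) (s t : ℝ) :
    HasDerivAt (fun r => G (r, t)) (fderiv ℝ G (s, t) (1, 0)) s :=
  ((hG.differentiable (by simp) (s, t)).hasFDerivAt).comp_hasDerivAt s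
    ((hasDerivAt_id s).prodMk (hasDerivAt_const s t))

theorem hasDerivAt_snd {G : ℝ × ℝ → ℝ} (hG : ContDiff ℝ ∞ G) (s t : ℝ) :
    HasDerivAt (fun r => G (s, r)) (fderiv ℝ G (s, t) (0, 1)) t :=
  ((hG.differentiable (by simp) (s, t)).hasFDerivAt).comp_hasDerivAt t
    ((hasDerivAt_const t s).prodMk (hasDerivAt_id t))

theorem hasMatDerivAt_fst (hA : IsSmoothMat A) (s t : ℝ) :
    HasMatDerivAt (fun r => A (r, t)) (Wallach.dirDeriv (1, 0) A (s, t)) s :=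
  fun i j => hasDerivAt_fst (hA i j) s t

theorem hasMatDerivAt_snd (hA : IsSmoothMat A) (s t : ℝ) :
    HasMatDerivAt (fun r => A (s, r)) (Wallach.dirDeriv (0, 1) A (s, t)) t :=
  fun i j => hasDerivAt_snd (hA i j) s t

theorem dirDeriv_comm (hA : IsSmoothMat A) (v w p : ℝ × ℝ) :
    Wallach.dirDeriv v (Wallach.dirDeriv w A) p = Wallach.dirDeriv w (Wallach.dirDeriv v A) p := by
  ext i j
  have hd : DifferentiableAt ℝ (fderiv ℝ fun q => A q i j) p :=
    ((hA i j).fderiv_right (m := ∞) (by simp)).differentiable (by simp) p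
  have key : ∀ u : ℝ × ℝ, fderiv ℝ (fun q => fderiv ℝ (fun q => A q i j) q u) p =
      (fderiv ℝ (fderiv ℝ fun q => A q i j) p).flip u := by
    intro u
    exact (hd.hasFDerivAt.clm_apply (hasFDerivAt_const u p)).fderiv.trans (by ext <;> simp)
  change fderiv ℝ (fun q => fderiv ℝ (fun q => A q i j) q w) p v =
    fderiv ℝ (fun q => fderiv ℝ (fun q => A q i j) q v) p w
  rw [key, key]
  -- Symmetry of the second derivative, for which class `C²` suffices over the reals.
  exact ((hA i j).contDiffAt.isSymmSndFDerivAt (by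
    rw [minSmoothness_of_isRCLikeNormedField]
    exact WithTop.coe_le_coe.2 (le_top : (2 : ℕ∞) ≤ ⊤))) v w

end IsSmoothMat

theorem hasDerivAt_integral_of_contDiff {G : ℝ × ℝ → ℝ} (hG : ContDiff ℝ ∞ G) (a b s : ℝ) :
    HasDerivAt (fun r => ∫ t in a..b, G (r, t)) (∫ t in a..b, fderiv ℝ G (s, t) (1, 0)) s := by
  have hc : Continuous fun p => fderiv ℝ G p (1, 0) :=
    ((hG.fderiv_right (m := ∞) (by simp)).clm_apply contDiff_const).continuous
  -- The dominating function is constant: a bound of the continuous derivative on a compact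
  -- rectangle around `s`.
  obtain ⟨K, hK⟩ := ((isCompact_Icc (a := s - 1) (b := s + 1)).prod
    (isCompact_uIcc (a := a) (b := b))).exists_bound_of_continuousOn hc.continuousOn
  refine (intervalIntegral.hasDerivAt_integral_of_dominated_loc_of_deriv_le
    (F := fun r t => G (r, t)) (F' := fun r t => fderiv ℝ G (r, t) (1, 0)) (bound := fun _ => K)
    (Icc_mem_nhds (sub_one_lt s) (lt_add_one s)) ?_ ?_ ?_ ?_ ?_ ?_).2
  · exact Filter.Eventually.of_forall fun r =>
      (hG.continuous.comp (by fun_prop : Continuous fun t : ℝ => (r, t))).aestronglyMeasurable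
  · exact (hG.continuous.comp (by fun_prop : Continuous fun t : ℝ => (s, t))).intervalIntegrable _ _
  · exact (hc.comp (by fun_prop : Continuous fun t : ℝ => (s, t))).aestronglyMeasurable
  · exact Filter.Eventually.of_forall fun t ht r hr => hK (r, t) ⟨hr, Set.uIoc_subset_uIcc ht⟩
  · exact intervalIntegrable_const
  · exact Filter.Eventually.of_forall fun t _ r _ => IsSmoothMat.hasDerivAt_fst hG r t

/-! ### The exponential -/

section Exponential

open scoped Matrix.Norms.Operator

theorem hasMatDerivAt_exp (X : Mat6) (t : ℝ) :
    HasMatDerivAt (fun r => NormedSpace.exp (r • X)) (X * NormedSpace.exp (t • X)) t := by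
  intro i j
  exact ((LinearMap.toContinuousLinearMap (Matrix.entryLinearMap ℝ ℝ i j)).hasFDerivAt).comp_hasDerivAt
    t (hasDerivAt_exp_smul_const' X t)

theorem contDiff_exp_apply (X : Mat6) (i j : Fin 6) :
    ContDiff ℝ ∞ fun t : ℝ => (NormedSpace.exp (t • X) : Mat6) i j := by
  have h1 : ContDiff ℝ ∞ (NormedSpace.exp : Mat6 → Mat6) := by
    rw [contDiff_iff_contDiffAt]
    exact fun x => (NormedSpace.exp_analytic (𝕂 := ℝ) x).contDiffAt
  have h2 : ContDiff ℝ ∞ fun t : ℝ => t • X := contDiff_id.smul contDiff_const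
  exact (LinearMap.toContinuousLinearMap (Matrix.entryLinearMap ℝ ℝ i j)).contDiff.comp (h1.comp h2)

theorem commute_exp {X Y : Mat6} (h : Commute Y X) (t : ℝ) : Commute Y (NormedSpace.exp (t • X)) :=
  (h.smul_right t).exp_right

end Exponential

/-- The one-parameter group `exp(tX)` in `SO(6)`. -/
noncomputable def expSO (X : so6) (t : ℝ) : SO6 :=
  ⟨NormedSpace.exp ((t • X : so6) : Mat6), exp_mem_SO6 (t • X).2⟩

theorem coe_expSO (X : so6) (t : ℝ) : (expSO X t : Mat6) = NormedSpace.exp (t • (X : Mat6)) := rfl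

theorem expSO_zero (X : so6) : expSO X 0 = 1 := by
  apply Subtype.ext
  rw [coe_expSO, zero_smul, NormedSpace.exp_zero]
  rfl

theorem commute_expSO (X : so6) (t : ℝ) {Y : Mat6} (h : Commute Y X) : Commute Y (expSO X t) :=
  commute_exp h t

theorem hasMatDerivAt_expSO (X : so6) (t : ℝ) :
    HasMatDerivAt (fun r => (expSO X r : Mat6)) ((X : Mat6) * expSO X t) t :=
  hasMatDerivAt_exp X t

theorem isSmoothCurve_expSO (X : so6) : IsSmoothCurve (expSO X) :=
  fun i j => contDiff_exp_apply X i j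

/-! ### The first variation of the energy -/

/-- The matrix of a two-parameter family in `SO(6)`. -/
def famMat (f : ℝ → ℝ → SO6) (p : ℝ × ℝ) : Mat6 := f p.1 p.2

/-- The left logarithmic derivative of a family in the direction of its second parameter. -/
noncomputable def logDeriv (f : ℝ → ℝ → SO6) (p : ℝ × ℝ) : Mat6 :=
  (famMat f p)ᵀ * dirDeriv (0, 1) (famMat f) p

/-- The right logarithmic derivative of a family in the direction of its first parameter. -/
noncomputable def varField (f : ℝ → ℝ → SO6) (p : ℝ × ℝ) : Mat6 :=
  dirDeriv (1, 0) (famMat f) p * (famMat f p)ᵀ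

/-- The eigenvalues of a metric on the blocks, put to zero on the diagonal blocks. -/
noncomputable def InvariantMetric.offdiag (Λ : InvariantMetric) (α β : Fin 3) : ℝ :=
  if α = β then 0 else Λ.scalar α β

/-- The entrywise inner product of matrices. -/
def entryInner (A C : Mat6) : ℝ := ∑ i, ∑ j, A i j * C i j

theorem entryInner_eq_trace (A C : Mat6) : entryInner A C = (Aᵀ * C).trace := by
  simp only [entryInner, Matrix.trace, Matrix.diag, Matrix.mul_apply, Matrix.transpose_apply]
  exact Finset.sum_comm

theorem entryInner_conj (A C F : Mat6) :
    entryInner A (Fᵀ * C * F) = entryInner (F * A * Fᵀ) C := by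
  rw [entryInner_eq_trace, entryInner_eq_trace, Matrix.transpose_mul, Matrix.transpose_mul,
    Matrix.transpose_transpose, ← mul_assoc, Matrix.trace_mul_comm]
  simp only [mul_assoc]

theorem InvariantMetric.blockScale_offdiag (Λ : InvariantMetric) (X : 𝔪) :
    blockScale Λ.offdiag X = blockScale Λ.scalar X := by
  ext i j
  rw [blockScale_apply, blockScale_apply, InvariantMetric.offdiag]
  split_ifs with h
  · rw [apply_eq_zero X h, mul_zero, mul_zero]
  · rfl

theorem InvariantMetric.offdiag_comm (Λ : InvariantMetric) (α β : Fin 3) :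
    Λ.offdiag α β = Λ.offdiag β α := by
  simp only [InvariantMetric.offdiag, eq_comm (a := α), Λ.scalar_comm α β]

theorem InvariantMetric.blockScale_eq_zero (Λ : InvariantMetric) {A : Mat6} (hA : IsBlockDiag A) :
    blockScale Λ.offdiag A = 0 := by
  ext i j
  rw [blockScale_apply, InvariantMetric.offdiag]
  split_ifs with h
  · simp
  · simp [hA i j h]

theorem InvariantMetric.entryInner_blockScale (Λ : InvariantMetric) (X : Mat6) {A : Mat6}
    (hA : IsBlockDiag A) : entryInner (blockScale Λ.offdiag X) A = 0 := by
  refine Finset.sum_eq_zero fun i _ => Finset.sum_eq_zero fun j _ => ?_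
  rw [blockScale_apply, InvariantMetric.offdiag]
  split_ifs with h
  · simp
  · simp [hA i j h]

/-- `blockScale Λ.offdiag` kills block diagonal matrices, so the projection to `𝔪` can be dropped
and the energy becomes a quadratic expression in the logarithmic derivative. -/
theorem InvariantMetric.inner_proj (Λ : InvariantMetric) {W : Mat6} (hW : W ∈ so6) :
    Λ.inner (proj W) (proj W) = entryInner (blockScale Λ.offdiag W) W := by
  rw [InvariantMetric.inner, B_of_mem_so6 _ (proj W).2.1]
  refine Finset.sum_congr rfl fun i _ => Finset.sum_congr rfl fun j _ => ?_
  rw [Λ.coe_op_apply, blockScale_apply, InvariantMetric.offdiag]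
  have := mem_so6_iff.1 hW i j
  split_ifs with h
  · simp [proj, h]
  · simp only [proj, Matrix.of_apply, if_neg h]
    rw [show (W i j - W j i) / 2 = W i j by linarith]

theorem famMat_mul_transpose (f : ℝ → ℝ → SO6) (p : ℝ × ℝ) :
    famMat f p * (famMat f p)ᵀ = 1 := (f p.1 p.2).mul_transpose

theorem famMat_transpose_mul (f : ℝ → ℝ → SO6) (p : ℝ × ℝ) :
    (famMat f p)ᵀ * famMat f p = 1 := (f p.1 p.2).transpose_mul

theorem isSmoothMat_famMat {f : ℝ → ℝ → SO6} (hf : IsSmoothFamily f) : IsSmoothMat (famMat f) := hf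

theorem isSmoothMat_logDeriv {f : ℝ → ℝ → SO6} (hf : IsSmoothFamily f) : IsSmoothMat (logDeriv f) :=
  (isSmoothMat_famMat hf).transpose.mul ((isSmoothMat_famMat hf).dirDeriv _)

theorem isSmoothMat_varField {f : ℝ → ℝ → SO6} (hf : IsSmoothFamily f) : IsSmoothMat (varField f) :=
  ((isSmoothMat_famMat hf).dirDeriv _).mul (isSmoothMat_famMat hf).transpose

theorem deriv_transpose_mul_fst {f : ℝ → ℝ → SO6} (hf : IsSmoothFamily f) (s t : ℝ) :
    (dirDeriv (1, 0) (famMat f) (s, t))ᵀ * famMat f (s, t) +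
      (famMat f (s, t))ᵀ * dirDeriv (1, 0) (famMat f) (s, t) = 0 := by
  have h := (isSmoothMat_famMat hf).hasMatDerivAt_fst s t
  exact ((h.transpose.mul h).congr fun r => (famMat_transpose_mul f (r, t)).symm).unique
    (hasMatDerivAt_const 1 s)

theorem deriv_transpose_mul_snd {f : ℝ → ℝ → SO6} (hf : IsSmoothFamily f) (s t : ℝ) :
    (dirDeriv (0, 1) (famMat f) (s, t))ᵀ * famMat f (s, t) + logDeriv f (s, t) = 0 := by
  have h := (isSmoothMat_famMat hf).hasMatDerivAt_snd s t
  exact ((h.transpose.mul h).congr fun r => (famMat_transpose_mul f (s, r)).symm).unique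
    (hasMatDerivAt_const 1 t)

theorem logDeriv_mem_so6 {f : ℝ → ℝ → SO6} (hf : IsSmoothFamily f) (s t : ℝ) : logDeriv f (s, t) ∈ so6 := by
  have h := deriv_transpose_mul_snd hf s t
  change (logDeriv f (s, t))ᵀ = -logDeriv f (s, t)
  rw [← eq_neg_of_add_eq_zero_left h, logDeriv, Matrix.transpose_mul, Matrix.transpose_transpose]

theorem velocity_eq {f : ℝ → ℝ → SO6} (hf : IsSmoothFamily f) (s t : ℝ) : velocity (f s) t = proj (logDeriv f (s, t)) := by
  rw [velocity, logDeriv, SO6.coe_inv]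
  congr 2
  ext i j
  exact ((isSmoothMat_famMat hf).hasMatDerivAt_snd s t i j).deriv

theorem energy_eq {f : ℝ → ℝ → SO6} (hf : IsSmoothFamily f) (Λ : InvariantMetric) (a b s : ℝ) :
    energy Λ a b (f s) =
      (1 / 2) * ∫ t in a..b, entryInner (blockScale Λ.offdiag (logDeriv f (s, t)))
        (logDeriv f (s, t)) := by
  simp only [energy, velocity_eq hf, Λ.inner_proj (logDeriv_mem_so6 hf s _)]

theorem hasDerivAt_energy {f : ℝ → ℝ → SO6} (hf : IsSmoothFamily f) (Λ : InvariantMetric) (a b s : ℝ) :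
    HasDerivAt (fun r => energy Λ a b (f r))
      (∫ t in a..b, entryInner (blockScale Λ.offdiag (logDeriv f (s, t)))
        (dirDeriv (1, 0) (logDeriv f) (s, t))) s := by
  have hW := isSmoothMat_logDeriv hf
  have hG : ContDiff ℝ ∞ fun p => entryInner (blockScale Λ.offdiag (logDeriv f p))
      (logDeriv f p) :=
    ContDiff.sum fun i _ => ContDiff.sum fun j _ => (contDiff_const.mul (hW i j)).mul (hW i j)
  have h := (hasDerivAt_integral_of_contDiff hG a b s).const_mul (1 / 2)
  rw [show (fun r => energy Λ a b (f r)) = _ from funext fun r => energy_eq hf Λ a b r]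
  refine h.congr_deriv ?_
  rw [← intervalIntegral.integral_const_mul]
  congr 1
  ext t
  have h1 : HasDerivAt (fun r => entryInner (blockScale Λ.offdiag (logDeriv f (r, t)))
      (logDeriv f (r, t))) (2 * entryInner (blockScale Λ.offdiag (logDeriv f (s, t)))
        (dirDeriv (1, 0) (logDeriv f) (s, t))) s := by
    have h2 : HasDerivAt (fun r => entryInner (blockScale Λ.offdiag (logDeriv f (r, t)))
        (logDeriv f (r, t))) _ s :=
      HasDerivAt.fun_sum fun i _ => HasDerivAt.fun_sum fun j _ =>
        ((hW.hasMatDerivAt_fst s t i j).const_mul (Λ.offdiag (blk i) (blk j))).mul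
          (hW.hasMatDerivAt_fst s t i j)
    refine h2.congr_deriv ?_
    simp only [entryInner, Finset.mul_sum, blockScale_apply]
    refine Finset.sum_congr rfl fun i _ => Finset.sum_congr rfl fun j _ => ?_
    ring
  rw [(IsSmoothMat.hasDerivAt_fst hG s t).unique h1]
  ring

/-- Exchanging the derivatives of the two logarithmic derivatives. -/
theorem dirDeriv_logDeriv {f : ℝ → ℝ → SO6} (hf : IsSmoothFamily f) (s t : ℝ) :
    dirDeriv (1, 0) (logDeriv f) (s, t) =
      (famMat f (s, t))ᵀ * dirDeriv (0, 1) (varField f) (s, t) * famMat f (s, t) := by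
  have hF := isSmoothMat_famMat hf
  have h1 := ((isSmoothMat_logDeriv hf).hasMatDerivAt_fst s t).unique
    ((hF.hasMatDerivAt_fst s t).transpose.mul ((hF.dirDeriv (0, 1)).hasMatDerivAt_fst s t))
  have h2 := ((isSmoothMat_varField hf).hasMatDerivAt_snd s t).unique
    (((hF.dirDeriv (1, 0)).hasMatDerivAt_snd s t).mul (hF.hasMatDerivAt_snd s t).transpose)
  have h3 := deriv_transpose_mul_fst hf s t
  have h4 := deriv_transpose_mul_snd hf s t
  have h5 := famMat_transpose_mul f (s, t)
  rw [h1, h2, hF.dirDeriv_comm]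
  rw [logDeriv] at h4
  have h6 := eq_neg_of_add_eq_zero_left h3
  have h7 := eq_neg_of_add_eq_zero_left h4
  have h8 := famMat_mul_transpose f (s, t)
  generalize dirDeriv (0, 1) (dirDeriv (1, 0) (famMat f)) (s, t) = Fst at *
  generalize dirDeriv (0, 1) (famMat f) (s, t) = Ft at *
  generalize dirDeriv (1, 0) (famMat f) (s, t) = Fs at *
  generalize famMat f (s, t) = F at *
  -- Both `Fᵀ F_s` and `Fᵀ F_t` are skew-symmetric; this turns `F_sᵀ F_t` into `Fᵀ F_s F_tᵀ F`.
  have h9 : Fsᵀ = -(Fᵀ * Fs * Fᵀ) := by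
    calc Fsᵀ = Fsᵀ * F * Fᵀ := by rw [mul_assoc, h8, mul_one]
      _ = _ := by rw [h6, neg_mul]
  calc Fsᵀ * Ft + Fᵀ * Fst = Fᵀ * Fst * (Fᵀ * F) + Fᵀ * Fs * (Ftᵀ * F) := by
        rw [h5, h7, h9]
        noncomm_ring
    _ = _ := by noncomm_ring

/-! ### Orbits of one-parameter groups as geodesics -/

theorem orbit_eq (X : so6) (t : ℝ) : orbit X t = (expSO X t : M) := rfl

theorem commute_transpose_expSO (X : so6) (t : ℝ) {Y : Mat6} (h : Commute Y X) :
    Commute Y (expSO X t : Mat6)ᵀ := by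
  have h1 : Y * expSO X t = expSO X t * Y := commute_expSO X t h
  have h2 := (expSO X t).mul_transpose
  have h3 := (expSO X t).transpose_mul
  generalize (expSO X t : Mat6) = e at *
  calc Y * eᵀ = eᵀ * (e * Y) * eᵀ := by rw [← mul_assoc, h3, one_mul]
    _ = eᵀ * Y * (e * eᵀ) := by rw [← h1]; noncomm_ring
    _ = eᵀ * Y := by rw [h2, mul_one]

theorem mk_eq_iff (g h : SO6) : (g : M) = h ↔ h⁻¹ * g ∈ H := by
  rw [eq_comm, QuotientGroup.eq]

theorem isBlockDiag_of_mk_eq {g h : SO6} (e : (g : M) = h) :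
    IsBlockDiag ((h : Mat6)ᵀ * (g : Mat6)) :=
  ((mk_eq_iff g h).1 e).1

/-- The momentum `exp(tX) (ΛX) exp(-tX)` of a variation of an orbit is constant if `X` commutes
with `ΛX`. -/
theorem momentum_eq {f : ℝ → ℝ → SO6} (hf : IsSmoothFamily f) (Λ : InvariantMetric) (X : 𝔪)
    (hX : Commute (blockScale Λ.offdiag X) (X : Mat6)) {a b t : ℝ} (ht : t ∈ Set.Ioo a b)
    (h0 : ∀ t ∈ Set.Icc a b, (f 0 t : M) = orbit ⟨X, X.2.1⟩ t) :
    famMat f (0, t) * blockScale Λ.offdiag (logDeriv f (0, t)) * (famMat f (0, t))ᵀ =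
      blockScale Λ.offdiag X := by
  set e := expSO ⟨X, X.2.1⟩ with he
  have hF := (isSmoothMat_famMat hf).hasMatDerivAt_snd 0 t
  have hh := (hasMatDerivAt_expSO ⟨X, X.2.1⟩ t).transpose.mul hF
  have hb : ∀ r ∈ Set.Icc a b, IsBlockDiag ((e r : Mat6)ᵀ * famMat f (0, r)) :=
    fun r hr => isBlockDiag_of_mk_eq (h0 r hr)
  have hbt := hb t ⟨ht.1.le, ht.2.le⟩
  -- The lift agrees with the orbit modulo `H` only on `[a, b]`, so its block diagonal factor is
  -- differentiated in the open interval.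
  have hb' := hh.isBlockDiag (by
    filter_upwards [Ioo_mem_nhds ht.1 ht.2] with r hr using hb r ⟨hr.1.le, hr.2.le⟩)
  have hXt : (X : Mat6)ᵀ = -X := X.2.1
  have e1 := (e t).mul_transpose
  have e3 : Commute (blockScale Λ.offdiag X) (e t : Mat6)ᵀ :=
    commute_transpose_expSO ⟨X, X.2.1⟩ t hX
  have e4 : Commute (X : Mat6) (e t : Mat6)ᵀ :=
    commute_transpose_expSO ⟨X, X.2.1⟩ t (Commute.refl _)
  have f1 := famMat_mul_transpose f (0, t)
  rw [← he, Matrix.transpose_mul, hXt, mul_neg] at hb'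
  -- Writing the lift as `exp(tX) h` with `h` block diagonal gives `W = hᵀ X h + hᵀ h'`. The last
  -- term is block diagonal and is killed by `blockScale Λ.offdiag`.
  have hW : logDeriv f (0, t) = ((e t : Mat6)ᵀ * famMat f (0, t))ᵀ * X *
        ((e t : Mat6)ᵀ * famMat f (0, t)) +
      ((e t : Mat6)ᵀ * famMat f (0, t))ᵀ *
        (-((e t : Mat6)ᵀ * X) * famMat f (0, t) +
          (e t : Mat6)ᵀ * dirDeriv (0, 1) (famMat f) (0, t)) := by
    rw [logDeriv]
    generalize (e t : Mat6) = E at *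
    generalize famMat f (0, t) = F at *
    generalize dirDeriv (0, 1) (famMat f) (0, t) = Ft at *
    rw [Matrix.transpose_mul, Matrix.transpose_transpose, ← e4.eq]
    calc Fᵀ * Ft = Fᵀ * (E * Eᵀ) * Ft := by rw [e1, mul_one]
      _ = _ := by noncomm_ring
  have hadd : ∀ A C : Mat6, blockScale Λ.offdiag (A + C) =
      blockScale Λ.offdiag A + blockScale Λ.offdiag C := fun A C => by
    ext i j
    simp only [blockScale_apply, Matrix.add_apply, mul_add]
  rw [hW, hadd, Λ.blockScale_eq_zero (hbt.transpose.mul hb'), add_zero, hbt.blockScale_mul,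
    hbt.transpose.mul_blockScale]
  generalize (e t : Mat6) = E at *
  generalize famMat f (0, t) = F at *
  generalize blockScale Λ.offdiag X = Y at *
  rw [Matrix.transpose_mul, Matrix.transpose_transpose]
  calc F * (Fᵀ * E * Y * (Eᵀ * F)) * Fᵀ = (F * Fᵀ) * E * (Y * Eᵀ) * (F * Fᵀ) := by noncomm_ring
    _ = (E * Eᵀ) * Y := by rw [f1, e3.eq, one_mul, mul_one, mul_assoc]
    _ = Y := by rw [e1, one_mul]

/-- The boundary term of the first variation vanishes if the end point is fixed. -/
theorem boundary_eq_zero {f : ℝ → ℝ → SO6} (hf : IsSmoothFamily f) (Λ : InvariantMetric) (X : 𝔪)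
    (hX : Commute (blockScale Λ.offdiag X) (X : Mat6)) {t : ℝ}
    (h0 : ∀ s, (f s t : M) = orbit ⟨X, X.2.1⟩ t) :
    entryInner (blockScale Λ.offdiag X) (varField f (0, t)) = 0 := by
  set e := expSO ⟨X, X.2.1⟩ t with he
  have hF := (isSmoothMat_famMat hf).hasMatDerivAt_fst 0 t
  have hk := (hasMatDerivAt_const (e : Mat6)ᵀ 0).mul hF
  have hb : ∀ r, IsBlockDiag ((e : Mat6)ᵀ * famMat f (r, t)) :=
    fun r => isBlockDiag_of_mk_eq (h0 r)
  have hb' := hk.isBlockDiag (Filter.Eventually.of_forall hb)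
  rw [zero_mul, zero_add] at hb'
  have e1 := e.mul_transpose
  have e3 : Commute (blockScale Λ.offdiag X) (e : Mat6)ᵀ :=
    commute_transpose_expSO ⟨X, X.2.1⟩ t hX
  -- At a fixed end point, conjugating `F_s Fᵀ` by `exp(-tX)` gives a block diagonal matrix,
  -- orthogonal to `ΛX`; and `ΛX` is unchanged by conjugation with `exp(tX)`.
  have h := Λ.entryInner_blockScale X (hb'.mul (hb 0).transpose)
  rw [varField]
  generalize (e : Mat6) = E at *
  generalize famMat f (0, t) = F at *
  generalize dirDeriv (1, 0) (famMat f) (0, t) = Fs at *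
  generalize blockScale Λ.offdiag X = Y at *
  have h2 : Eᵀ * Fs * (Eᵀ * F)ᵀ = Eᵀ * (Fs * Fᵀ) * E := by
    rw [Matrix.transpose_mul, Matrix.transpose_transpose]
    noncomm_ring
  rw [h2, entryInner_conj] at h
  have h3 : E * Y * Eᵀ = Y := by rw [mul_assoc, e3.eq, ← mul_assoc, e1, one_mul]
  rwa [h3] at h

/-- With constant momentum the integrand of the first variation is the exact derivative of `⟨ΛX,
V⟩`, and both boundary values are zero. -/
theorem isGeodesic_orbit (Λ : InvariantMetric) (X : 𝔪)
    (hX : Commute (blockScale Λ.offdiag X) (X : Mat6)) : IsGeodesic Λ (orbit ⟨X, X.2.1⟩) := by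
  refine ⟨⟨expSO ⟨X, X.2.1⟩, isSmoothCurve_expSO _, fun t => rfl⟩, ?_⟩
  intro a b hab f hf h0 ha hb
  refine (hasDerivAt_energy hf Λ a b 0).congr_deriv ?_
  set Y := blockScale Λ.offdiag X with hY
  have hV := isSmoothMat_varField hf
  have h1 : ∫ t in a..b, entryInner (blockScale Λ.offdiag (logDeriv f (0, t)))
      (dirDeriv (1, 0) (logDeriv f) (0, t)) =
      ∫ t in a..b, entryInner Y (dirDeriv (0, 1) (varField f) (0, t)) := by
    refine intervalIntegral.integral_congr_Ioo_of_le hab.le fun t ht => ?_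
    rw [dirDeriv_logDeriv hf, entryInner_conj, momentum_eq hf Λ X hX ht h0]
  have h2 : ∀ t ∈ Set.uIcc a b, HasDerivAt (fun t => entryInner Y (varField f (0, t)))
      (entryInner Y (dirDeriv (0, 1) (varField f) (0, t))) t := fun t _ =>
    HasDerivAt.fun_sum fun i _ => HasDerivAt.fun_sum fun j _ =>
      (hV.hasMatDerivAt_snd 0 t i j).const_mul (Y i j)
  have h3 : Continuous fun t : ℝ => entryInner Y (dirDeriv (0, 1) (varField f) (0, t)) :=
    continuous_finsetSum _ fun i _ => continuous_finsetSum _ fun j _ =>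
      continuous_const.mul (((hV.dirDeriv (0, 1)) i j).continuous.comp
        (by fun_prop : Continuous fun t : ℝ => ((0 : ℝ), t)))
  rw [h1, intervalIntegral.integral_eq_sub_of_hasDerivAt h2 (h3.intervalIntegrable _ _),
    boundary_eq_zero hf Λ X hX ha, boundary_eq_zero hf Λ X hX hb, sub_zero]

/-! ### Geodesic orbits satisfy the equigeodesic equation -/

/-- The variation `exp(tX) exp(s t (1 - t) Z)` of the orbit of `X` on `[0, 1]`. -/
noncomputable def orbitVariation (X Z : so6) (s t : ℝ) : SO6 :=
  expSO X t * expSO Z (s * (t * (1 - t)))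

theorem isSmoothFamily_orbitVariation (X Z : so6) : IsSmoothFamily (orbitVariation X Z) := by
  intro i j
  have h1 : ∀ i j, ContDiff ℝ ∞ fun p : ℝ × ℝ => (expSO X p.2 : Mat6) i j :=
    fun i j => (isSmoothCurve_expSO X i j).comp contDiff_snd
  have h2 : ∀ i j, ContDiff ℝ ∞
      fun p : ℝ × ℝ => (expSO Z (p.1 * (p.2 * (1 - p.2))) : Mat6) i j :=
    fun i j => (isSmoothCurve_expSO Z i j).comp
      (contDiff_fst.mul (contDiff_snd.mul (contDiff_const.sub contDiff_snd)))
  exact IsSmoothMat.mul (A := fun p : ℝ × ℝ => (expSO X p.2 : Mat6)) h1 h2 i j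

theorem logDeriv_orbitVariation (X Z : so6) (s t : ℝ) :
    logDeriv (orbitVariation X Z) (s, t) =
      (expSO Z (s * (t * (1 - t))) : Mat6)ᵀ * X * expSO Z (s * (t * (1 - t))) +
        (s * (1 - 2 * t)) • (Z : Mat6) := by
  have hu : HasDerivAt (fun r : ℝ => s * (r * (1 - r))) (s * (1 - 2 * t)) t := by
    refine (((hasDerivAt_id t).mul ((hasDerivAt_const t (1 : ℝ)).sub
      (hasDerivAt_id t))).const_mul s).congr_deriv ?_
    simp only [id, Pi.sub_apply]
    ring
  have h1 := ((isSmoothMat_famMat (isSmoothFamily_orbitVariation X Z)).hasMatDerivAt_snd s t).unique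
    ((hasMatDerivAt_expSO X t).mul (HasMatDerivAt.scomp (t := t) (hasMatDerivAt_expSO Z (s * (t * (1 - t)))) hu))
  have h2 : famMat (orbitVariation X Z) (s, t) =
    (expSO X t : Mat6) * expSO Z (s * (t * (1 - t))) := rfl
  rw [logDeriv, h1, h2]
  have e1 := (expSO X t).transpose_mul
  have e2 := (expSO Z (s * (t * (1 - t)))).transpose_mul
  have e3 : (X : Mat6) * expSO X t = expSO X t * X := commute_expSO X t (Commute.refl _)
  have e4 : (Z : Mat6) * expSO Z (s * (t * (1 - t))) = expSO Z (s * (t * (1 - t))) * Z :=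
    commute_expSO Z _ (Commute.refl _)
  generalize (expSO Z (s * (t * (1 - t))) : Mat6) = G at *
  generalize (expSO X t : Mat6) = E at *
  rw [e3, e4, Matrix.transpose_mul, mul_add, Matrix.mul_smul, Matrix.mul_smul]
  congr 1
  · calc Gᵀ * Eᵀ * (E * X * G) = Gᵀ * (Eᵀ * E) * X * G := by noncomm_ring
      _ = _ := by rw [e1, mul_one]
  · congr 1
    calc Gᵀ * Eᵀ * (E * (G * Z)) = Gᵀ * (Eᵀ * E) * G * Z := by noncomm_ring
      _ = _ := by rw [e1, mul_one, e2, one_mul]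

theorem logDeriv_orbitVariation_zero (X Z : so6) (t : ℝ) :
    logDeriv (orbitVariation X Z) (0, t) = X := by
  rw [logDeriv_orbitVariation, zero_mul, zero_mul, expSO_zero]
  change (1 : Mat6)ᵀ * X * 1 + _ = _
  simp

/-- The bracket comes from conjugating `X` by `exp(-s t(1-t) Z)`, the other term from the
`t`-derivative of the exponent. -/
theorem dirDeriv_logDeriv_orbitVariation (X Z : so6) (t : ℝ) :
    dirDeriv (1, 0) (logDeriv (orbitVariation X Z)) (0, t) =
      (t * (1 - t)) • ⁅(X : Mat6), (Z : Mat6)⁆ + (1 - 2 * t) • (Z : Mat6) := by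
  have hu : ∀ c : ℝ, HasDerivAt (fun r : ℝ => r * c) c 0 := fun c => by
    simpa using (hasDerivAt_id (0 : ℝ)).mul_const c
  have hG : HasMatDerivAt (fun r => (expSO Z (r * (t * (1 - t))) : Mat6))
      ((t * (1 - t)) • (Z : Mat6)) 0 := by
    have h := HasMatDerivAt.scomp (t := 0) (hasMatDerivAt_expSO Z (0 * (t * (1 - t))))
      (hu (t * (1 - t)))
    rw [zero_mul, expSO_zero] at h
    simpa using h
  have hZ : (Z : Mat6)ᵀ = -Z := Z.2
  have h1 := ((isSmoothMat_logDeriv (isSmoothFamily_orbitVariation X Z)).hasMatDerivAt_fst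
    0 t).unique ((((hG.transpose.mul (hasMatDerivAt_const X 0)).mul hG).add
      ((hasMatDerivAt_const (Z : Mat6) 0).smul (hu (1 - 2 * t)))).congr
        fun r => logDeriv_orbitVariation X Z r t)
  rw [h1, zero_mul, zero_mul, expSO_zero]
  change (_ * X + (1 : Mat6)ᵀ * 0) * (1 : Mat6) + (1 : Mat6)ᵀ * X * _ + _ = _
  simp only [Matrix.transpose_smul, hZ, Matrix.transpose_one, Ring.lie_def, Matrix.smul_mul,
    Matrix.mul_smul, mul_zero, add_zero, mul_one, one_mul, smul_zero, smul_neg, neg_mul, smul_sub]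
  abel

/-- Testing criticality with the variation in the direction `Z = [X, ΛX]` itself gives `|Z|² = 0`.
This holds for each metric separately. -/
theorem lie_eq_zero_of_isGeodesic (Λ : InvariantMetric) (X : 𝔪)
    (h : IsGeodesic Λ (orbit ⟨X, X.2.1⟩)) : ⁅(X : Mat6), (Λ.op X : Mat6)⁆ = 0 := by
  have hXt : (X : Mat6)ᵀ = -X := X.2.1
  have hYt : (Λ.op X : Mat6)ᵀ = -(Λ.op X : Mat6) := (Λ.op X).2.1
  set Z : Mat6 := ⁅(X : Mat6), (Λ.op X : Mat6)⁆ with hZ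
  have hZm : Z ∈ so6 := by
    change Zᵀ = -Z
    rw [hZ, Ring.lie_def, Matrix.transpose_sub, Matrix.transpose_mul, Matrix.transpose_mul, hXt,
      hYt]
    noncomm_ring
  set f := orbitVariation ⟨X, X.2.1⟩ ⟨Z, hZm⟩ with hf
  have hf' : IsSmoothFamily f := isSmoothFamily_orbitVariation _ _
  have hend : ∀ s t : ℝ, s * (t * (1 - t)) = 0 → (f s t : M) = orbit ⟨X, X.2.1⟩ t := by
    intro s t hst
    rw [orbit_eq, hf, orbitVariation, hst, expSO_zero, mul_one]
  have hE := h.2 0 1 one_pos f hf' (fun t _ => hend 0 t (by ring)) (fun s => hend s 0 (by ring))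
    (fun s => hend s 1 (by ring))
  have h1 := hE.unique (hasDerivAt_energy hf' Λ 0 1 0)
  have h2 : ∀ t : ℝ, entryInner (blockScale Λ.offdiag (logDeriv f (0, t)))
      (dirDeriv (1, 0) (logDeriv f) (0, t)) =
      (t - t ^ 2) * entryInner (Λ.op X) ⁅(X : Mat6), Z⁆ + (1 - 2 * t) * entryInner (Λ.op X) Z := by
    intro t
    rw [hf, logDeriv_orbitVariation_zero, dirDeriv_logDeriv_orbitVariation,
      Λ.blockScale_offdiag, ← Λ.coe_op]
    simp only [entryInner, Finset.mul_sum, ← Finset.sum_add_distrib]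
    refine Finset.sum_congr rfl fun i _ => Finset.sum_congr rfl fun j _ => ?_
    simp only [Matrix.add_apply, Matrix.smul_apply, smul_eq_mul]
    ring
  simp only [h2] at h1
  -- The weight `t(1-t)` vanishes at both ends and has integral `1/6`; its derivative `1 - 2t`
  -- integrates to zero.
  have h3 : ∀ p q : ℝ, ∫ t in (0 : ℝ)..1, ((t - t ^ 2) * p + (1 - 2 * t) * q) = p / 6 := by
    intro p q
    have hd : ∀ t ∈ Set.uIcc (0 : ℝ) 1, HasDerivAt
        (fun t : ℝ => (t ^ 2 / 2 - t ^ 3 / 3) * p + (t - t ^ 2) * q)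
        ((t - t ^ 2) * p + (1 - 2 * t) * q) t := by
      intro t _
      have d2 := hasDerivAt_pow 2 t
      have d3 := hasDerivAt_pow 3 t
      refine ((((d2.div_const 2).sub (d3.div_const 3)).mul_const p).add
        (((hasDerivAt_id t).sub d2).mul_const q)).congr_deriv ?_
      push_cast
      ring
    rw [intervalIntegral.integral_eq_sub_of_hasDerivAt hd
      ((by fun_prop : Continuous fun t : ℝ =>
        (t - t ^ 2) * p + (1 - 2 * t) * q).intervalIntegrable _ _)]
    ring
  rw [h3] at h1
  -- Invariance of the trace form: `⟨ΛX, [X, Z]⟩ = -⟨[X, ΛX], Z⟩`.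
  have h4 : entryInner (Λ.op X) ⁅(X : Mat6), Z⁆ = -entryInner Z Z := by
    have hZt : Zᵀ = -Z := hZm
    rw [entryInner_eq_trace, entryInner_eq_trace, hYt, hZt, neg_mul, neg_mul, Matrix.trace_neg,
      Matrix.trace_neg, neg_neg, Ring.lie_def, mul_sub, Matrix.trace_sub, ← mul_assoc, ← mul_assoc,
      Matrix.trace_mul_comm (_ * Z), ← mul_assoc, ← Matrix.trace_sub, ← sub_mul, ← Matrix.trace_neg,
      ← neg_mul, neg_sub, ← Ring.lie_def]
  have h5 : entryInner Z Z = 0 := by linarith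
  ext i j
  have h6 := (Finset.sum_eq_zero_iff_of_nonneg fun i _ =>
    Finset.sum_nonneg fun j _ => mul_self_nonneg (Z i j)).1 h5 i (Finset.mem_univ i)
  have h7 := (Finset.sum_eq_zero_iff_of_nonneg fun j _ => mul_self_nonneg (Z i j)).1 h6 j
    (Finset.mem_univ j)
  exact mul_self_eq_zero.1 h7

/-! ### Equivalence of the three descriptions -/

theorem IsEquigeodesicVector.equation {X : Mat6} (hX : X ∈ 𝔪) (h : IsEquigeodesicVector X) :
    EquigeodesicEquation ⟨X, hX⟩ := by
  intro Λ
  obtain ⟨_, h⟩ := h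
  rw [lie_eq_zero_of_isGeodesic Λ ⟨X, hX⟩ (h Λ)]
  exact proj_of_mem_𝔥 𝔥.zero_mem

theorem Coeffs.System.isEquigeodesicVector {a : Coeffs} (h : a.System) :
    IsEquigeodesicVector a.vec := by
  refine ⟨a.vec_mem_𝔪, fun Λ => isGeodesic_orbit Λ ⟨a.vec, a.vec_mem_𝔪⟩ ?_⟩
  have := h.lie_eq_zero Λ.offdiag_comm
  rw [Ring.lie_def, sub_eq_zero] at this
  exact this.symm

theorem isEquigeodesicVector_iff_system (a : Coeffs) : IsEquigeodesicVector a.vec ↔ a.System :=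
  ⟨fun h => (h.equation a.vec_mem_𝔪).system, fun h => h.isEquigeodesicVector⟩

theorem equigeodesicEquation_iff_system (a : Coeffs) :
    EquigeodesicEquation ⟨a.vec, a.vec_mem_𝔪⟩ ↔ a.System :=
  ⟨fun h => h.system, fun h => h.isEquigeodesicVector.equation a.vec_mem_𝔪⟩

theorem isEquigeodesicVector_iff_mem_family (X : Mat6) :
    IsEquigeodesicVector X ↔ ∃ i, X ∈ family i := by
  rw [exists_mem_family_iff]
  constructor
  · intro h
    obtain ⟨a, rfl⟩ := exists_coeffs h.1
    exact ⟨a, (isEquigeodesicVector_iff_system a).1 h, rfl⟩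
  · rintro ⟨a, ha, rfl⟩
    exact ha.isEquigeodesicVector

end Wallach

theorem mainTheorem3 :
    -- equigeodesic vectors, the equigeodesic equation, and the bilinear system
    (∀ a : Coeffs, (IsEquigeodesicVector a.vec ↔ EquigeodesicEquation ⟨a.vec, a.vec_mem_𝔪⟩) ∧
      (EquigeodesicEquation ⟨a.vec, a.vec_mem_𝔪⟩ ↔ a.System)) ∧
    -- the system is not identically zero
    (∃ a : Coeffs, ¬ a.System) ∧
    -- the equigeodesic vectors are exactly the members of the six families
    (∀ X : Mat6, IsEquigeodesicVector X ↔ ∃ i, X ∈ family i) ∧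
    -- none of the six families is contained in the union of the others
    (∀ i, ∃ X ∈ family i, ∀ j, j ≠ i → X ∉ family j) ∧
    -- position of the families
    (family 0 ⊆ (𝔪12 ⊔ 𝔪23 : Submodule ℝ Mat6) ∧ family 1 ⊆ (𝔪12 ⊔ 𝔪23 : Submodule ℝ Mat6) ∧
      family 2 ⊆ (𝔪12 ⊔ 𝔪23 : Submodule ℝ Mat6) ∧
      family 3 ⊆ (𝔪13 ⊔ 𝔪23 : Submodule ℝ Mat6) ∧ family 4 ⊆ (𝔪13 ⊔ 𝔪23 : Submodule ℝ Mat6) ∧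
      family 5 = (𝔪23 : Set Mat6)) ∧
    -- only the last family consists of trivial vectors
    (∀ i, (∀ X ∈ family i, IsTrivial X) ↔ i = 5) := by
  exact ⟨fun a => ⟨(isEquigeodesicVector_iff_system a).trans
      (equigeodesicEquation_iff_system a).symm, equigeodesicEquation_iff_system a⟩,
    -- The vector `ξ₁₂ + ξ₁₅` violates `a15 * a12 = 0`.
    ⟨⟨1, 0, 0, 1, 0, 0, 0, 0, 0, 0, 0⟩, fun h => one_ne_zero ((mul_one (1 : ℝ)).symm.trans h.1.1)⟩,
    isEquigeodesicVector_iff_mem_family, family_independent,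
    ⟨family_position.1, family_position.2.1, family_position.2.2.1, family_position.2.2.2.1,
      family_position.2.2.2.2, family6_eq⟩,
    family_trivial_iff⟩
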